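/- **Setting.** Let $\mathcal L=\{\mathbf f,\mathbf u,\mathbf t\}$ with the truth order $\mathbf f\le\mathbf u\le\mathbf t$ and negation ${\sim}\mathbf t=\mathbf f$, ${\sim}\mathbf f=\mathbf t$, ${\sim}\mathbf u=\mathbf u$. A *fact space* is a set $\mathcal F\supseteq\mathcal L$ with an involution ${\sim}$ extending the negation of $\mathcal L$ such that ${\sim}x\ne x$ for $x\neq\mathbf u$. For $A\subseteq\mathcal F$ put ${\sim}A=\{{\sim}a: a\in A\}$. A *justification frame* consists of a set $\mathcal F_d\subseteq\mathcal F\setminus\mathcal L$ of *defined* facts, closed under ${\sim}$ (the other facts are *open*), and a set $R$ of rules $x\leftarrow A$ with $x\in\mathcal F_d$ and $\emptyset\ne A\subseteq\mathcal F$, such that every $x\in\mathcal F_d$ has at least one rule. A selection function for $x$ is a map $s$ with $s(A)\in A$ for every rule $x\leftarrow A$, and $\mathrm{Im}(s)=\{s(A): (x\leftarrow A)\in R\}$. The frame is *complementary* if 1. it is fixed under complementation: for every $x\in\mathcal F_d$ and every selection function $s$ for $x$, the rule ${\sim}x\leftarrow{\sim}\mathrm{Im}(s)$ is in $R$; and 2.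 the rules for $x$ and ${\sim}x$ are opposed: $A\cap{\sim}B\ne\emptyset$ whenever $x\leftarrow A$ and ${\sim}x\leftarrow B$ are in $R$. A *branch* is an infinite sequence in $\mathcal F_d$, or a finite non-empty sequence in $\mathcal F_d$ followed by an open fact; ${\sim}b$ is obtained from a branch $b$ by applying ${\sim}$ to each element. A *branch evaluation* $\mathcal B$ maps branches to facts; it is *consistent* if $\mathcal B({\sim}b)={\sim}\mathcal B(b)$ for all $b$. An *interpretation* is a map $\mathcal I:\mathcal F\to\mathcal L$ with $\mathcal I({\sim}x)={\sim}\mathcal I(x)$ that is the identity on $\mathcal L$. A *finite path* is a (possibly empty) finite sequence of defined facts in which each next element occurs in the body of some rule for the previous one. A *loop* at $x$ is a non-empty finite path $q$ starting in $x$ such that $q\to x$ is a path. For a set $M$ of loops at $x$, $M^*$ and $M^\omega$ are the sets of finite (possibly empty) and infinite concatenations of members of $M$. With respect to $\mathcal I$, the branch evaluation $\mathcal B$ is * *monotone* if for all branches $b_1,b_2$ starting in the same fact $x$ and all finite paths $p$ such that $p\to x$ is a path, $\mathcal I(\mathcal B(b_1))\le\mathcal I(\mathcal B(b_2))$ implies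 $\mathcal I(\mathcal B(p\to b_1))\le\mathcal I(\mathcal B(p\to b_2))$; * *selective* if for all $x\in\mathcal F_d$, all finite paths $p$ such that $p\to x$ is a path, all sets $M,N$ of loops at $x$, all sets $K$ of branches starting in $x$, and every $b\in p(M\cup N)^*K\cup p(M\cup N)^\omega$, there are $b_*,b^*\in pM^\omega\cup pN^\omega\cup pK$ with $\mathcal I(\mathcal B(b_*))\le\mathcal I(\mathcal B(b))\le\mathcal I(\mathcal B(b^*))$. A *justification* is a directed graph with nodes labelled by facts such that for every node $n$ with an outgoing edge, the rule whose head is the label of $n$ and whose body is the set of labels of the children of $n$ is in $R$. It is *graph-like* if no two nodes have the same label, *tree-like* if its underlying undirected graph is acyclic, and *locally complete* if no leaf has a defined label. For $x\in\mathcal F_d$ and a locally complete justification $J$ with a node labelled $x$, let $\mathrm{val}(J,x,\mathcal I)=\bigwedge_b\mathcal I(\mathcal B(b))$, where $b$ ranges over the label sequences of the paths in $J$ that start in a node labelled $x$ and are infinite or end in a leaf. The *graph-like supported value* $\mathrm{SV}_g(x,\mathcal I)$ (resp. *tree-like supported value* $\mathrm{SV}_t(x,\mathcal I)$) of $x\in\mathcal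 F_d$ is the least upper bound of $\mathrm{val}(J,x,\mathcal I)$ over all locally complete graph-like (resp. tree-like) justifications $J$ with a node labelled $x$; for open $x$ both are $\mathcal I(x)$. **Corollary.** Let $\mathcal F$ be finite, let the justification frame be complementary, let $\mathcal B$ be a consistent branch evaluation, and let $\mathcal I$ be an interpretation with respect to which $\mathcal B$ is monotone and selective. Then $$\mathrm{SV}_g({\sim}x,\mathcal I)={\sim}\,\mathrm{SV}_g(x,\mathcal I)\quad\text{for all }x\in\mathcal F_d,\qquad\text{and}\qquad \mathrm{SV}_g(x,\mathcal I)=\mathrm{SV}_t(x,\mathcal I)\quad\text{for all }x\in\mathcal F.$$ In particular, if $\mathcal B$ is monotone and selective with respect to every interpretation, this holds for all interpretations $\mathcal I$. -/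

import Mathlib

universe u

/-- The three logical values: false, unknown, true. -/
inductive Truth : Type
  | fls
  | unk
  | tru

namespace Truth

/-- Position in the truth order `fls < unk < tru`. -/
def rank : Truth → ℕ
  | fls => 0
  | unk => 1
  | tru => 2

theorem rank_injective : Function.Injective rank := by
  intro a b h
  cases a <;> cases b <;> simp_all [rank]

/-- The truth order `fls ≤ unk ≤ tru`. -/
instance : LinearOrder Truth := LinearOrder.lift' rank rank_injective

instance : Fintype Truth where
  elems := ⟨[fls, unk, tru], by simp⟩
  complete := by intro a; cases a <;> simp

instance : Nonempty Truth := ⟨unk⟩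

/-- The truth order is a (finite, hence complete) lattice. -/
noncomputable instance : CompleteLinearOrder Truth :=
  Fintype.toCompleteLinearOrderOfNonempty Truth

/-- Negation of logical values. -/
def neg : Truth → Truth
  | fls => tru
  | unk => unk
  | tru => fls

end Truth

/-- A fact space: a set containing the three logical values, with an involution `compl`
that extends the negation of logical values and whose only fixed point is `unk`. -/
class FactSpace (F : Type u) where
  logical : Truth → F
  logical_injective : Function.Injective logical
  compl : F → F
  compl_compl : ∀ x, compl (compl x) = x
  compl_logical : ∀ v, compl (logical v) = logical v.neg
  compl_ne : ∀ x, x ≠ logical Truth.unk → compl x ≠ x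

/-- A justification frame: a set of defined facts and a set of rules `(x, A)` with head `x` and
body `A`. -/
structure JustificationFrame (F : Type u) [FactSpace F] where
  defined : Set F
  compl_mem : ∀ x ∈ defined, FactSpace.compl x ∈ defined
  logical_notMem : ∀ v, FactSpace.logical v ∉ defined
  rules : Set (F × Set F)
  head_mem : ∀ x A, (x, A) ∈ rules → x ∈ defined
  body_nonempty : ∀ x A, (x, A) ∈ rules → A.Nonempty
  exists_rule : ∀ x ∈ defined, ∃ A, (x, A) ∈ rules

/-- A three-valued interpretation of a fact space. -/
structure Interpretation (F : Type u) [FactSpace F] where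
  val : F → Truth
  val_compl : ∀ x, val (FactSpace.compl x) = (val x).neg
  val_logical : ∀ v, val (FactSpace.logical v) = v

/-- A directed graph with nodes labelled by facts. -/
structure LabelledGraph (F : Type u) where
  Node : Type u
  edge : Node → Node → Prop
  label : Node → F

namespace LabelledGraph

variable {F : Type u}

/-- An internal node has an outgoing edge. -/
def IsInternal (J : LabelledGraph F) (n : J.Node) : Prop := ∃ m, J.edge n m

/-- A leaf has no outgoing edge. -/
def IsLeaf (J : LabelledGraph F) (n : J.Node) : Prop := ¬ J.IsInternal n

/-- The underlying undirected graph has no cycles, where a self-loop counts as a cycle of length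
one and a pair of opposite edges counts as a cycle of length two. -/
def IsForest (J : LabelledGraph F) : Prop :=
  (SimpleGraph.fromRel J.edge).IsAcyclic ∧ ∀ n m, J.edge n m → ¬ J.edge m n

end LabelledGraph

namespace JustificationFrame

variable {F : Type u} [FactSpace F]

/-! ### Complementation -/

/-- The cases of `x`: the bodies of the rules with head `x`. -/
def cases (JF : JustificationFrame F) (x : F) : Set (Set F) := {A | (x, A) ∈ JF.rules}

/-- A selection function for `x` chooses an element from each case of `x` (only its values on the
cases of `x` are relevant). -/
def IsSelection (JF : JustificationFrame F) (x : F) (s : Set F → F) : Prop :=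
  ∀ A ∈ JF.cases x, s A ∈ A

/-- The rules `∼x ← ∼Im(s)` for `x` defined and `s` a selection function for `x`. -/
def complRules (JF : JustificationFrame F) : Set (F × Set F) :=
  {r | ∃ x ∈ JF.defined, ∃ s : Set F → F, JF.IsSelection x s ∧
    r = (FactSpace.compl x, FactSpace.compl '' (s '' JF.cases x))}

/-- The frame is fixed under complementation, i.e. under adding the rules in `complRules`. -/
def IsComplementary (JF : JustificationFrame F) : Prop :=
  JF.rules ∪ JF.complRules = JF.rules

/-- The rules for `x` and for `∼x` do not contradict each other: every body of a rule for `x`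
contains the complement of some element of every body of a rule for `∼x`. -/
def HasOpposedRules (JF : JustificationFrame F) : Prop :=
  ∀ x A B, (x, A) ∈ JF.rules → (FactSpace.compl x, B) ∈ JF.rules →
    (A ∩ FactSpace.compl '' B).Nonempty

/-! ### Branches and branch evaluations -/

/-- Defined facts. -/
abbrev Defined (JF : JustificationFrame F) : Type u := {x : F // x ∈ JF.defined}

/-- Open facts. -/
abbrev Open (JF : JustificationFrame F) : Type u := {x : F // x ∉ JF.defined}

/-- A branch is a finite non-empty sequence of defined facts followed by an open fact, or an
infinite sequence of defined facts. -/
inductive Branch (JF : JustificationFrame F) : Type u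
  | finite (l : List JF.Defined) (hl : l ≠ []) (o : JF.Open) : Branch JF
  | infinite (s : ℕ → JF.Defined) : Branch JF

/-- Complement of a defined fact. -/
def Defined.compl {JF : JustificationFrame F} (x : JF.Defined) : JF.Defined :=
  ⟨FactSpace.compl x.1, JF.compl_mem x.1 x.2⟩

/-- Complement of an open fact. -/
def Open.compl {JF : JustificationFrame F} (x : JF.Open) : JF.Open :=
  ⟨FactSpace.compl x.1, fun h => x.2 (by
    have := JF.compl_mem _ h
    rwa [FactSpace.compl_compl] at this)⟩

namespace Branch

variable {JF : JustificationFrame F}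

/-- The first element of a branch. -/
def start : JF.Branch → JF.Defined
  | finite l hl _ => l.head hl
  | infinite s => s 0

/-- The branch `∼b`, obtained by complementing every element of `b`. -/
def compl : JF.Branch → JF.Branch
  | finite l hl o => finite (l.map Defined.compl) (by simpa using hl) (Open.compl o)
  | infinite s => infinite fun i => Defined.compl (s i)

/-- The branch `p → b`: the finite sequence `p` followed by the branch `b`. -/
def prepend (p : List JF.Defined) : JF.Branch → JF.Branch
  | finite l hl o => finite (p ++ l) (by simp [hl]) o
  | infinite s => infinite fun i => if h : i < p.length then p[i] else s (i - p.length)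

end Branch

/-- A branch evaluation on the branches of `JF`. A justification frame together with a branch
evaluation is a justification system. -/
abbrev BranchEvaluation (JF : JustificationFrame F) : Type u := JF.Branch → F

/-- `y` occurs in the body of a rule for `x`. -/
def Step (JF : JustificationFrame F) (x y : JF.Defined) : Prop :=
  ∃ A, (x.1, A) ∈ JF.rules ∧ y.1 ∈ A

/-- `p → x` is a path; `p` may be empty. -/
def IsPathTo (JF : JustificationFrame F) (p : List JF.Defined) (x : JF.Defined) : Prop :=
  List.IsChain JF.Step (p ++ [x])

/-- `p` is a finite loop starting in `x`: `p` is non-empty, starts in `x`, and `p → x` is a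
path. -/
def IsLoop (JF : JustificationFrame F) (x : JF.Defined) (p : List JF.Defined) : Prop :=
  p.head? = some x ∧ JF.IsPathTo p x

/-- `M^*`: the finite concatenations of members of `M`. -/
def star {JF : JustificationFrame F} (M : Set (List JF.Defined)) : Set (List JF.Defined) :=
  {p | ∃ L : List (List JF.Defined), (∀ q ∈ L, q ∈ M) ∧ p = L.flatten}

/-- `M^ω`: the infinite concatenations `q 0, q 1, q 2, …` of members of `M`; for each `n`, the
sequence `s` begins with `q 0, …, q (n - 1)`. -/
def omega {JF : JustificationFrame F} (M : Set (List JF.Defined)) : Set JF.Branch :=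
  {b | ∃ (q : ℕ → List JF.Defined) (s : ℕ → JF.Defined), (∀ n, q n ∈ M) ∧
    (∀ n, (List.range ((List.range n).flatMap q).length).map s = (List.range n).flatMap q) ∧
    b = Branch.infinite s}

namespace BranchEvaluation

variable {JF : JustificationFrame F}

/-- Consistency: `B (∼b) = ∼(B b)` for all branches `b`. -/
def IsConsistent (B : JF.BranchEvaluation) : Prop :=
  ∀ b, B b.compl = FactSpace.compl (B b)

/-- Monotonicity with respect to an interpretation. -/
def IsMonotone (B : JF.BranchEvaluation) (I : Interpretation F) : Prop :=
  ∀ (b₁ b₂ : JF.Branch) (x : JF.Defined) (p : List JF.Defined),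
    b₁.start = x → b₂.start = x → JF.IsPathTo p x →
    I.val (B b₁) ≤ I.val (B b₂) → I.val (B (b₁.prepend p)) ≤ I.val (B (b₂.prepend p))

/-- Selectivity with respect to an interpretation. -/
def IsSelective (B : JF.BranchEvaluation) (I : Interpretation F) : Prop :=
  ∀ (p : List JF.Defined) (x : JF.Defined), JF.IsPathTo p x →
    ∀ (M N : Set (List JF.Defined)) (K : Set JF.Branch),
      (∀ q ∈ M, JF.IsLoop x q) → (∀ q ∈ N, JF.IsLoop x q) → (∀ b ∈ K, b.start = x) →
      ∀ b ∈ Set.image2 Branch.prepend (star (M ∪ N)) K ∪ omega (M ∪ N),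
        ∃ c ∈ omega M ∪ omega N ∪ K, ∃ d ∈ omega M ∪ omega N ∪ K,
          I.val (B (c.prepend p)) ≤ I.val (B (b.prepend p)) ∧
          I.val (B (b.prepend p)) ≤ I.val (B (d.prepend p))

end BranchEvaluation

/-! ### Justifications and supported values -/

/-- The labels of the children of an internal node form a case of its label. -/
def IsJustification (JF : JustificationFrame F) (J : LabelledGraph F) : Prop :=
  ∀ n, J.IsInternal n → (J.label n, {y | ∃ m, J.edge n m ∧ y = J.label m}) ∈ JF.rules

/-- Graph-like justifications: no two nodes have the same label. -/
def IsGraphLike (JF : JustificationFrame F) (J : LabelledGraph F) : Prop :=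
  JF.IsJustification J ∧ Function.Injective J.label

/-- Tree-like justifications: the underlying undirected graph is a forest. -/
def IsTreeLike (JF : JustificationFrame F) (J : LabelledGraph F) : Prop :=
  JF.IsJustification J ∧ J.IsForest

/-- No leaf is labelled with a defined fact. -/
def IsLocallyComplete (JF : JustificationFrame F) (J : LabelledGraph F) : Prop :=
  ∀ n, J.IsLeaf n → J.label n ∉ JF.defined

/-- `b` is the sequence of labels of a path in `J` that starts in a node labelled `x` and is
infinite or ends in a leaf. In a locally complete justification every such path, for `x` defined,
gives a branch. -/
def IsBranchOf (JF : JustificationFrame F) (J : LabelledGraph F) (x : F) : JF.Branch → Prop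
  | .finite l hl o => (l.head hl).1 = x ∧ ∃ (ns : List J.Node) (m : J.Node),
      List.IsChain J.edge (ns ++ [m]) ∧ J.IsLeaf m ∧
      ns.map J.label = l.map Subtype.val ∧ J.label m = o.1
  | .infinite s => (s 0).1 = x ∧ ∃ ns : ℕ → J.Node,
      (∀ i, J.edge (ns i) (ns (i + 1))) ∧ ∀ i, J.label (ns i) = (s i).1

/-- The value of `x` by the justification `J`: the greatest lower bound of the values of its
branches starting in `x`. -/
noncomputable def justValue (JF : JustificationFrame F) (B : JF.BranchEvaluation)
    (J : LabelledGraph F) (x : F) (I : Interpretation F) : Truth :=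
  sInf {v | ∃ b, JF.IsBranchOf J x b ∧ v = I.val (B b)}

open Classical in
/-- The graph-like supported value: for defined `x`, the least upper bound of the values of `x` by
the locally complete graph-like justifications with a node labelled `x`. -/
noncomputable def graphSupportedValue (JF : JustificationFrame F) (B : JF.BranchEvaluation)
    (x : F) (I : Interpretation F) : Truth :=
  if x ∈ JF.defined then
    sSup {v | ∃ J : LabelledGraph F, JF.IsGraphLike J ∧ JF.IsLocallyComplete J ∧
      (∃ n, J.label n = x) ∧ v = JF.justValue B J x I}
  else I.val x

open Classical in
/-- The tree-like supported value. -/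
noncomputable def treeSupportedValue (JF : JustificationFrame F) (B : JF.BranchEvaluation)
    (x : F) (I : Interpretation F) : Truth :=
  if x ∈ JF.defined then
    sSup {v | ∃ J : LabelledGraph F, JF.IsTreeLike J ∧ JF.IsLocallyComplete J ∧
      (∃ n, J.label n = x) ∧ v = JF.justValue B J x I}
  else I.val x

end JustificationFrame

/-!
A game is played on the facts: at a defined fact one player chooses a rule for it and the opponent
chooses the next fact in its body, and the resulting branch is worth its value under `B` and `I`.
A positional strategy of the first player is a graph-like justification, and a strategy with memory
is, after unravelling, a tree-like one. By complementarity the answers of the opponent at `x`, one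
in each body, form a selection function and hence a rule for `∼x`, so a positional strategy of the
opponent is, after complementation, a graph-like justification too. For opposed rules, two
justifications for `x` and for `∼x` always have a pair of complementary branches, so the value of
`x` by the first is at most the complement of the value of `∼x` by the second. Everything therefore
follows from positional determinacy of the game.

Positional determinacy of finite games with monotone and selective payoffs is proved by induction on
the game. If a player has a choice at a position `t`, split the options at `t` into two smaller
games. The player keeps to the better one. The opponent combines optimal positional strategies for
both, switching between them according to the option taken at the last visit of `t`; by selectivity
the alternation gains nothing. This strategy of the opponent needs memory. If both players have
choices, then each of them has an optimal positional strategy in one of two such splittings; if only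
one of them has, the other needs no memory.
-/

namespace Truth

theorem neg_le_neg_iff {a b : Truth} : a.neg ≤ b.neg ↔ b ≤ a := by
  cases a <;> cases b <;> decide

theorem le_neg_comm {a b : Truth} : a ≤ b.neg ↔ b ≤ a.neg := by
  cases a <;> cases b <;> decide

end Truth

namespace PositionalGame

variable {X A L Q Q' : Type*}

/-- `w` is an infinite path of the graph `E`. -/
def IsPlay (E : X → X → Prop) (w : ℕ → X) : Prop := ∀ i, E (w i) (w (i + 1))

/-- The sequence `w 0, …, w (n - 1), d 0, d 1, …`. -/
def splice (n : ℕ) (w d : ℕ → X) : ℕ → X := fun i => if i < n then w i else d (i - n)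

/-! ### Plays -/

theorem IsPlay.mono {E E' : X → X → Prop} {w : ℕ → X} (hw : IsPlay E w) (hE : E ≤ E') :
    IsPlay E' w := fun i => hE _ _ (hw i)

theorem IsPlay.shift {E : X → X → Prop} {w : ℕ → X} (hw : IsPlay E w) (n : ℕ) :
    IsPlay E fun i => w (i + n) := fun i => by
  simpa only [add_right_comm] using hw (i + n)

theorem exists_isPlay {E : X → X → Prop} (hE : ∀ x, ∃ y, E x y) (x : X) :
    ∃ w : ℕ → X, w 0 = x ∧ IsPlay E w := by
  choose next hnext using hE
  refine ⟨fun n => next^[n] x, rfl, fun i => ?_⟩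
  simpa only [Function.iterate_succ_apply'] using hnext _

theorem IsPlay.splice {E : X → X → Prop} {n : ℕ} {w d : ℕ → X}
    (hw : ∀ i < n, E (w i) (w (i + 1))) (hd : IsPlay E d) (hdw : d 0 = w n) :
    IsPlay E (splice n w d) := fun i => by
  rcases lt_trichotomy (i + 1) n with hi | hi | hi
  · simpa [PositionalGame.splice, hi, (Nat.lt_succ_self i).trans hi] using hw i (by omega)
  · simpa [PositionalGame.splice, ← hi, hdw] using hw i (by omega)
  · simpa [PositionalGame.splice, show ¬ i < n by omega, show ¬ i + 1 < n by omega,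
      Nat.sub_add_comm (Nat.lt_succ_iff.1 hi)] using hd (i - n)

/-! ### Payoffs -/

/-- Along plays of `E`, prefixing a move preserves the order of the payoffs. -/
def MonotonePayoff [LE L] (E : X → X → Prop) (val : (ℕ → X) → L) : Prop :=
  ∀ w₁ w₂ : ℕ → X, IsPlay E w₁ → IsPlay E w₂ → w₁ 0 = w₂ 0 → w₁ 1 = w₂ 1 →
    val (fun i => w₁ (i + 1)) ≤ val (fun i => w₂ (i + 1)) → val w₁ ≤ val w₂

/-- `w` is a sequence of moves in the graphs `H true` and `H false`, the `i`-th one in `H (c i)`,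
that changes between them only at visits of `t`. -/
def Alternates (H : Bool → X → X → Prop) (t : X) (w : ℕ → X) (c : ℕ → Bool) : Prop :=
  ∀ i, H (c i) (w i) (w (i + 1)) ∧ (w (i + 1) ≠ t → c (i + 1) = c i)

/-- Alternating between two subgraphs of `E` at visits of the initial position is no better than
staying in one of them. -/
def SelectivePayoff [LE L] (E : X → X → Prop) (val : (ℕ → X) → L) : Prop :=
  ∀ H : Bool → X → X → Prop, (∀ b, H b ≤ E) → ∀ w c, Alternates H (w 0) w c →
    ∃ (b : Bool) (d : ℕ → X), d 0 = w 0 ∧ IsPlay (H b) d ∧ val w ≤ val d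

theorem MonotonePayoff.dual [LE L] {E : X → X → Prop} {val : (ℕ → X) → L}
    (h : MonotonePayoff E val) : MonotonePayoff E (OrderDual.toDual ∘ val) :=
  fun w₁ w₂ h₁ h₂ h0 h1 hle => h w₂ w₁ h₂ h₁ h0.symm h1.symm hle

theorem MonotonePayoff.le_splice [LE L] {E : X → X → Prop} {val : (ℕ → X) → L}
    (h : MonotonePayoff E val) {d : ℕ → X} (hd : IsPlay E d) (n : ℕ) {w : ℕ → X}
    (hw : IsPlay E w) (hdw : d 0 = w n) (hle : val (fun i => w (i + n)) ≤ val d) :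
    val w ≤ val (splice n w d) := by
  induction n generalizing w with
  | zero =>
    have hsplice : splice 0 w d = d := funext fun i => by simp [splice]
    exact hsplice ▸ hle
  | succ n ih =>
    have htail : (fun i => splice (n + 1) w d (i + 1)) = splice n (fun i => w (i + 1)) d := by
      funext i
      simp [splice]
    refine h w _ hw (.splice (fun i _ => hw i) hd hdw) (by simp [splice]) ?_ ?_
    · rcases n.eq_zero_or_pos with rfl | hn
      · simp [splice, hdw]
      · simp [splice, hn]
    · rw [htail]
      exact ih (hw.shift 1) hdw (by simpa only [add_assoc, add_comm 1] using hle)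

theorem Alternates.shift {H : Bool → X → X → Prop} {t : X} {w : ℕ → X} {c : ℕ → Bool}
    (h : Alternates H t w c) (n : ℕ) :
    Alternates H t (fun i => w (i + n)) fun i => c (i + n) := fun i => by
  simpa only [add_right_comm] using h (i + n)

theorem Alternates.eq_of_forall_ne {H : Bool → X → X → Prop} {t : X} {w : ℕ → X} {c : ℕ → Bool}
    (h : Alternates H t w c) {n m : ℕ} (hne : ∀ i, n < i → i < m → w i ≠ t) {i : ℕ} (hni : n ≤ i)
    (him : i < m) : c i = c n := by
  induction i, hni using Nat.le_induction with
  | base => rfl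
  | succ i hi ih => rw [(h i).2 (hne _ (by omega) him), ih (by omega)]

theorem Alternates.isPlay {H : Bool → X → X → Prop} {t : X} {w : ℕ → X} {c : ℕ → Bool}
    (h : Alternates H t w c) (hne : ∀ i, w (i + 1) ≠ t) : IsPlay (H (c 0)) w := fun i => by
  rw [← h.eq_of_forall_ne (m := i + 1) (fun j hj _ => ?_) (Nat.zero_le i) i.lt_succ_self]
  · exact (h i).1
  · simpa [Nat.sub_add_cancel hj] using hne (j - 1)

/-- The tail from the first visit of `t` is replaced by the play `e`, which by selectivity is at
least as good; the result stays in `H true`. -/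
theorem Alternates.val_le [Preorder L] {E : X → X → Prop} {val : (ℕ → X) → L}
    (hmono : MonotonePayoff E val) (hsel : SelectivePayoff E val) {H : Bool → X → X → Prop}
    (hH : ∀ b, H b ≤ E) {v : Bool → X → L}
    (hv : ∀ b w, IsPlay (H b) w → val w ≤ v b (w 0)) {t : X} (ht : ∀ b, v b t ≤ v true t)
    {e : ℕ → X} (he : IsPlay (H true) e) (he0 : e 0 = t) (hve : v true t ≤ val e)
    {w : ℕ → X} {c : ℕ → Bool} (hw : Alternates H t w c) (hc : w 0 ≠ t → c 0 = true) :
    val w ≤ v true (w 0) := by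
  classical
  by_cases hvisit : ∃ n, w n = t
  · obtain ⟨n, hn, hmin⟩ : ∃ n, w n = t ∧ ∀ i < n, w i ≠ t :=
      ⟨Nat.find hvisit, Nat.find_spec hvisit, fun i => Nat.find_min hvisit⟩
    have hprefix : ∀ i < n, H true (w i) (w (i + 1)) := fun i hi => by
      rw [← hc (hmin 0 (by omega)),
        ← hw.eq_of_forall_ne (fun j _ hj => hmin j hj) (Nat.zero_le i) hi]
      exact (hw i).1
    obtain ⟨b, d, hd0, hd, hwd⟩ := hsel H hH (fun i => w (i + n)) (fun i => c (i + n))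
      (by simpa [hn] using hw.shift n)
    have htail : val (fun i => w (i + n)) ≤ val e := by
      have hd0 : d 0 = t := by simpa [hn] using hd0
      calc val (fun i => w (i + n)) ≤ val d := hwd
        _ ≤ v b t := hd0 ▸ hv b d hd
        _ ≤ v true t := ht b
        _ ≤ val e := hve
    have hsplice0 : splice n w e 0 = w 0 := by
      rcases n.eq_zero_or_pos with rfl | hpos
      · simp [splice, he0, hn]
      · simp [splice, hpos]
    calc val w ≤ val (splice n w e) :=
          hmono.le_splice (he.mono (hH true)) n (fun i => hH _ _ _ (hw i).1) (he0.trans hn.symm)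
            htail
      _ ≤ v true (w 0) := hsplice0 ▸ hv true _ (.splice hprefix he (he0.trans hn.symm))
  · push Not at hvisit
    exact hv true w (hc (hvisit 0) ▸ hw.isPlay fun i => hvisit (i + 1))

/-! ### One-step forcing and strategies -/

/-- The forcing operator of the other player: he can force the next position into `P` iff the
player with forcing operator `f` cannot force it into the complement of `P`. -/
def opponent (f : Set X →o Set X) : Set X →o Set X where
  toFun P := (f Pᶜ)ᶜ
  monotone' _ _ h := Set.compl_subset_compl.2 (f.monotone (Set.compl_subset_compl.2 h))

theorem mem_opponent {f : Set X →o Set X} {P : Set X} {x : X} :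
    x ∈ opponent f P ↔ x ∉ f Pᶜ := Iff.rfl

theorem opponent_opponent (f : Set X →o Set X) : opponent (opponent f) = f := by
  ext P x
  simp [mem_opponent]

theorem opponent_sup (f g : Set X →o Set X) : opponent (f ⊔ g) = opponent f ⊓ opponent g := by
  ext P x
  simp [mem_opponent]

theorem opponent_inf (f g : Set X →o Set X) : opponent (f ⊓ g) = opponent f ⊔ opponent g := by
  rw [← opponent_opponent (opponent f ⊔ opponent g), opponent_sup, opponent_opponent,
    opponent_opponent]

theorem inter_nonempty_of_mem_opponent {f : Set X →o Set X} {P P' : Set X} {x : X} (h : x ∈ f P)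
    (h' : x ∈ opponent f P') : (P ∩ P').Nonempty := by
  by_contra hempty
  rw [Set.not_nonempty_iff_eq_empty, ← Set.disjoint_iff_inter_eq_empty] at hempty
  exact h' (f.monotone hempty.subset_compl_right h)

/-- The graph `G`, whose nodes are labelled with positions, is a strategy for the player with
forcing operator `f`: at each node he can force the next position to be a label of a child. -/
def IsStrategy (f : Set X →o Set X) (label : Q → X) (G : Q → Q → Prop) : Prop :=
  ∀ q, label q ∈ f (label '' {q' | G q q'})

theorem IsStrategy.exists_common_play {f : Set X →o Set X} {label : Q → X} {G : Q → Q → Prop}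
    {label' : Q' → X} {G' : Q' → Q' → Prop} (hG : IsStrategy f label G)
    (hG' : IsStrategy (opponent f) label' G') {q : Q} {q' : Q'} (hq : label q = label' q') :
    ∃ w w', IsPlay G w ∧ IsPlay G' w' ∧ w 0 = q ∧ w' 0 = q' ∧ label ∘ w = label' ∘ w' := by
  obtain ⟨p, hp0, hp⟩ := exists_isPlay
    (E := fun p p' : {p : Q × Q' // label p.1 = label' p.2} =>
      G p.1.1 p'.1.1 ∧ G' p.1.2 p'.1.2) (by
        rintro ⟨⟨r, r'⟩, hr⟩
        have hr' : label r ∈ opponent f (label' '' {s' | G' r' s'}) := by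
          have hr : label r = label' r' := hr
          rw [hr]
          exact hG' r'
        obtain ⟨_, ⟨s, hs, hss'⟩, s', hs', rfl⟩ := inter_nonempty_of_mem_opponent (hG r) hr'
        exact ⟨⟨(s, s'), hss'⟩, hs, hs'⟩) ⟨(q, q'), hq⟩
  exact ⟨fun i => (p i).1.1, fun i => (p i).1.2, fun i => (hp i).1, fun i => (hp i).2,
    congrArg (·.1.1) hp0, congrArg (·.1.2) hp0, funext fun i => (p i).2⟩

/-- The player with forcing operator `f` has a positional strategy in the graph `E` whose plays
have payoff at least `v` at their initial position. -/
def SecuresPositionally [LE L] (E : X → X → Prop) (f : Set X →o Set X) (val : (ℕ → X) → L)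
    (v : X → L) : Prop :=
  ∃ G ≤ E, IsStrategy f id G ∧ ∀ w, IsPlay G w → v (w 0) ≤ val w

/-- The player with forcing operator `f` has a strategy with memory whose plays have payoff at
least `v` at their initial position. -/
def Secures [LE L] (f : Set X →o Set X) (val : (ℕ → X) → L) (v : X → L) : Prop :=
  ∃ (M : Type) (m₀ : M) (G : X × M → X × M → Prop), IsStrategy f Prod.fst G ∧
    ∀ w, IsPlay G w → (w 0).2 = m₀ → v (w 0).1 ≤ val (Prod.fst ∘ w)

theorem SecuresPositionally.secures [LE L] {E : X → X → Prop} {f : Set X →o Set X}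
    {val : (ℕ → X) → L} {v : X → L} (h : SecuresPositionally E f val v) : Secures f val v := by
  obtain ⟨G, -, hG, hval⟩ := h
  refine ⟨Unit, (), fun p q => G p.1 q.1, fun p => ?_, fun w hw _ => hval _ hw⟩
  refine f.monotone ?_ (hG p.1)
  rintro _ ⟨y, hy, rfl⟩
  exact ⟨(y, ()), hy, rfl⟩

theorem Secures.le_of_opponent [Preorder L] {f : Set X →o Set X} {val : (ℕ → X) → L}
    {v u : X → L} (h : Secures f val v)
    (h' : Secures (opponent f) (OrderDual.toDual ∘ val) (OrderDual.toDual ∘ u)) : v ≤ u := by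
  intro x
  obtain ⟨M, m₀, G, hG, hval⟩ := h
  obtain ⟨M', m₀', G', hG', hval'⟩ := h'
  obtain ⟨w, w', hw, hw', hstart, hstart₂, heq⟩ :=
    hG.exists_common_play hG' (q := (x, m₀)) (q' := (x, m₀')) rfl
  calc v x ≤ val (Prod.fst ∘ w) := by simpa [hstart] using hval w hw (by rw [hstart])
    _ = val (Prod.fst ∘ w') := by rw [heq]
    _ ≤ u x := by simpa [hstart₂] using hval' w' hw' (by rw [hstart₂])

/-- A player without choices needs no memory. -/
theorem Secures.securesPositionally [LE L] {E E' : X → X → Prop} {f : Set X →o Set X}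
    {val : (ℕ → X) → L} {v : X → L} (h : Secures f val v) (hEE' : E ≤ E')
    (hE : ∀ x, x ∈ f {y | E x y}) (hforced : ∀ x P, x ∈ f P → ∀ y, E x y → y ∈ P) :
    SecuresPositionally E' f val v := by
  obtain ⟨M, m₀, G, hG, hval⟩ := h
  refine ⟨E, hEE', fun x => by simpa using hE x, fun w hw => ?_⟩
  have hlift : ∀ p : X × M, ∀ y, E p.1 y → ∃ m, G p (y, m) := fun p y hy => by
    obtain ⟨⟨_, m⟩, hm, rfl⟩ := hforced _ _ (hG p) y hy
    exact ⟨m, hm⟩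
  have : Nonempty M := ⟨m₀⟩
  choose! mem hmem using hlift
  let p : ℕ → X × M := fun n => (w n, n.rec m₀ fun i m => mem (w i, m) (w (i + 1)))
  exact hval p (fun i => hmem (p i) _ (hw i)) rfl

/-- The forcing operator `f₁ ⊔ f₂` gives an additional choice between `f₁` and `f₂` at the position
`t`. Whoever has the choice takes the better option for good; the opponent answers `f₁` and `f₂`
with a positional strategy each and remembers which option was taken last. -/
theorem securesPositionally_and_secures_sup [Preorder L] {E : X → X → Prop}
    {val : (ℕ → X) → L} (hmono : MonotonePayoff E val) (hsel : SelectivePayoff E val)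
    {f : Bool → Set X →o Set X} {v : Bool → X → L} {t : X}
    (hoff : ∀ x, x ≠ t → ∀ b P, x ∈ f b P ↔ x ∈ f true P) (hle : ∀ b, v b t ≤ v true t)
    (hown : SecuresPositionally E (f true) val (v true))
    (hopp : ∀ b, SecuresPositionally E (opponent (f b)) (OrderDual.toDual ∘ val)
      (OrderDual.toDual ∘ v b)) :
    SecuresPositionally E (f true ⊔ f false) val (v true) ∧
      Secures (opponent (f true ⊔ f false)) (OrderDual.toDual ∘ val)
        (OrderDual.toDual ∘ v true) := by
  obtain ⟨G, hGE, hG, hGval⟩ := hown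
  choose H hHE hH hHval using hopp
  refine ⟨⟨G, hGE, fun x => Or.inl (hG x), hGval⟩, Bool, true,
    fun p q => H q.2 p.1 q.1 ∧ (p.1 ≠ t → q.2 = p.2), ?_, fun w hw hw0 => ?_⟩
  · rintro ⟨x, b⟩
    rw [opponent_sup]
    have hmem : ∀ b' : Bool, (x ≠ t → b' = b) → x ∈ opponent (f b')
        (Prod.fst '' {q : X × Bool | H q.2 x q.1 ∧ (x ≠ t → q.2 = b)}) := fun b' hb' => by
      refine (opponent (f b')).monotone ?_ (hH b' x)
      rintro _ ⟨y, hy, rfl⟩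
      exact ⟨(y, b'), ⟨hy, hb'⟩, rfl⟩
    by_cases hx : x = t
    · exact ⟨hmem true (absurd hx), hmem false (absurd hx)⟩
    · have hb := hmem b fun _ => rfl
      simp only [mem_opponent, hoff x hx b] at hb
      exact ⟨hb, by simpa only [SetLike.mem_coe, mem_opponent, hoff x hx false] using hb⟩
  · obtain ⟨e, e', he, he', he0, -, hee'⟩ := hG.exists_common_play (hH true) (q := t) rfl
    obtain rfl : e = e' := hee'
    exact Alternates.val_le hmono hsel hHE hHval hle he' he0 (he0 ▸ hGval e he)
      (w := Prod.fst ∘ w) (c := fun i => (w (i + 1)).2)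
      (fun i => ⟨(hw i).1, (hw (i + 1)).2⟩) fun h => ((hw 0).2 h).trans hw0

theorem exists_secures_sup [LinearOrder L] {E : X → X → Prop} {val : (ℕ → X) → L}
    (hmono : MonotonePayoff E val) (hsel : SelectivePayoff E val)
    {f : Bool → Set X →o Set X} {v : Bool → X → L} {t : X}
    (hoff : ∀ x, x ≠ t → ∀ b b' P, x ∈ f b P ↔ x ∈ f b' P)
    (hown : ∀ b, SecuresPositionally E (f b) val (v b))
    (hopp : ∀ b, SecuresPositionally E (opponent (f b)) (OrderDual.toDual ∘ val)
      (OrderDual.toDual ∘ v b)) :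
    ∃ u, SecuresPositionally E (f true ⊔ f false) val u ∧
      Secures (opponent (f true ⊔ f false)) (OrderDual.toDual ∘ val) (OrderDual.toDual ∘ u) := by
  rcases le_total (v false t) (v true t) with hle | hle
  · exact ⟨v true, securesPositionally_and_secures_sup hmono hsel (fun x hx b => hoff x hx b true)
      (Bool.forall_bool.2 ⟨hle, le_rfl⟩) (hown true) hopp⟩
  · rw [sup_comm]
    exact ⟨v false, securesPositionally_and_secures_sup (f := f ∘ not) (v := v ∘ not) hmono hsel
      (fun x hx b => hoff x hx (!b) false) (Bool.forall_bool.2 ⟨hle, le_rfl⟩) (hown false)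
      fun b => hopp (!b)⟩

/-! ### Positional determinacy -/

/-- At position `x` of the arena `E` one player chooses an action `a` with `E x a` non-empty and
the other one chooses the next position in `E x a`. `NoDeadEnds` says that this is always
possible. -/
def NoDeadEnds (E : X → A → Set X) : Prop := ∀ x, ∃ a, (E x a).Nonempty

/-- The pairs of successive positions in an arena. -/
def Move (E : X → A → Set X) (x y : X) : Prop := ∃ a, y ∈ E x a

/-- The forcing operator of the player who chooses the actions. -/
def force (E : X → A → Set X) : Set X →o Set X where
  toFun P := {x | ∃ a, (E x a).Nonempty ∧ E x a ⊆ P}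
  monotone' _ _ h _ := fun ⟨a, ha, hP⟩ => ⟨a, ha, hP.trans h⟩

theorem mem_force {E : X → A → Set X} {P : Set X} {x : X} :
    x ∈ force E P ↔ ∃ a, (E x a).Nonempty ∧ E x a ⊆ P := Iff.rfl

theorem mem_opponent_force {E : X → A → Set X} {P : Set X} {x : X} :
    x ∈ opponent (force E) P ↔ ∀ a, (E x a).Nonempty → (E x a ∩ P).Nonempty := by
  simp only [mem_opponent, mem_force, not_exists, not_and, Set.subset_compl_iff_disjoint_right,
    Set.not_disjoint_iff_nonempty_inter]

theorem Move.mono {E E' : X → A → Set X} (h : E ≤ E') : Move E ≤ Move E' :=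
  fun x _ ⟨a, ha⟩ => ⟨a, h x a ha⟩

theorem NoDeadEnds.exists_move {E : X → A → Set X} (hE : NoDeadEnds E) (x : X) :
    ∃ y, Move E x y :=
  let ⟨a, y, hy⟩ := hE x
  ⟨y, a, hy⟩

theorem NoDeadEnds.mem_force_move {E : X → A → Set X} (hE : NoDeadEnds E) (x : X) :
    x ∈ force E {y | Move E x y} :=
  let ⟨a, ha⟩ := hE x
  ⟨a, ha, fun _ hy => ⟨a, hy⟩⟩

theorem mem_opponent_force_move (E : X → A → Set X) (x : X) :
    x ∈ opponent (force E) {y | Move E x y} :=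
  mem_opponent_force.2 fun a ⟨y, hy⟩ => ⟨y, hy, a, hy⟩

theorem force_eq_sup {E : X → A → Set X} {E' : Bool → X → A → Set X}
    (hsub : ∀ b x a, E' b x a = E x a ∨ E' b x a = ∅) (hex : ∀ x a, ∃ b, E' b x a = E x a) :
    force E = force (E' true) ⊔ force (E' false) := by
  ext P x
  constructor
  · rintro ⟨a, ha⟩
    obtain ⟨b, hb⟩ := hex x a
    rw [← hb] at ha
    cases b
    · exact Or.inr ⟨a, ha⟩
    · exact Or.inl ⟨a, ha⟩
  · have hforce : ∀ b, x ∈ force (E' b) P → x ∈ force E P := by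
      rintro b ⟨a, ha, haP⟩
      have heq := (hsub b x a).resolve_right ha.ne_empty
      exact ⟨a, heq ▸ ha, heq ▸ haP⟩
    exact fun h => h.elim (hforce true) (hforce false)

theorem force_eq_inf {E : X → A → Set X} {E' : Bool → X → A → Set X} (hle : ∀ b, E' b ≤ E)
    (hne : ∀ b x a, (E x a).Nonempty → (E' b x a).Nonempty)
    (hunion : ∀ x a, E x a ⊆ E' true x a ∪ E' false x a)
    (heq : ∀ x a a', a ≠ a' → E' true x a = E x a ∨ E' false x a' = E x a') :
    force E = force (E' true) ⊓ force (E' false) := by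
  ext P x
  constructor
  · rintro ⟨a, ha, haP⟩
    exact ⟨⟨a, hne _ _ _ ha, (hle _ x a).trans haP⟩, ⟨a, hne _ _ _ ha, (hle _ x a).trans haP⟩⟩
  · rintro ⟨⟨a, ha, haP⟩, a', ha', haP'⟩
    by_cases haa' : a = a'
    · subst haa'
      exact ⟨a, ha.mono (hle _ _ _), (hunion x a).trans (Set.union_subset haP haP')⟩
    · rcases heq x a a' haa' with h | h
      · exact ⟨a, h ▸ ha, h ▸ haP⟩
      · exact ⟨a', h ▸ ha', h ▸ haP'⟩

theorem exists_force_eq_sup {E : X → A → Set X} (hE : NoDeadEnds E) {t : X} {a a' : A}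
    (ha : (E t a).Nonempty) (ha' : (E t a').Nonempty) (hne : a' ≠ a) :
    ∃ E' : Bool → X → A → Set X, (∀ b, E' b < E) ∧ (∀ b, NoDeadEnds (E' b)) ∧
      (∀ b, ∀ x ≠ t, E' b x = E x) ∧ force E = force (E' true) ⊔ force (E' false) := by
  let E' : Bool → X → A → Set X := fun b x c => {y ∈ E x c | x = t → (c = a ↔ b = true)}
  have hoff : ∀ b, ∀ x ≠ t, E' b x = E x := fun b x hx => by simp [E', hx]
  have hkeep : ∀ b c, (c = a ↔ b = true) → E' b t c = E t c := fun b c h => by simp [E', h]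
  have hdrop : ∀ b c, ¬(c = a ↔ b = true) → E' b t c = ∅ := fun b c h => by simp [E', h]
  refine ⟨E', fun b => lt_of_le_of_ne (fun x c y hy => hy.1) fun heq => ?_, fun b x => ?_, hoff,
    force_eq_sup (fun b x c => ?_) fun x c => ?_⟩
  · have heq := congrFun (congrFun heq t)
    cases b
    · exact ha.ne_empty ((heq a).symm.trans (hdrop _ _ (by simp)))
    · exact ha'.ne_empty ((heq a').symm.trans (hdrop _ _ (by simp [hne])))
  · by_cases hx : x = t
    · subst hx
      cases b
      · exact ⟨a', by rwa [hkeep _ _ (by simp [hne])]⟩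
      · exact ⟨a, by rwa [hkeep _ _ (by simp)]⟩
    · exact hoff b x hx ▸ hE x
  · by_cases hx : x = t
    · subst hx
      exact (em _).imp (hkeep b c) (hdrop b c)
    · exact Or.inl (by rw [hoff b x hx])
  · by_cases hx : x = t
    · subst hx
      by_cases hc : c = a
      · exact ⟨true, hkeep _ _ (by simp [hc])⟩
      · exact ⟨false, hkeep _ _ (by simp [hc])⟩
    · exact ⟨true, by rw [hoff true x hx]⟩

theorem exists_force_eq_inf {E : X → A → Set X} (hE : NoDeadEnds E) {t y y' : X} {a : A}
    (hy : y ∈ E t a) (hy' : y' ∈ E t a) (hne : y' ≠ y) :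
    ∃ E' : Bool → X → A → Set X, (∀ b, E' b < E) ∧ (∀ b, NoDeadEnds (E' b)) ∧
      (∀ b, ∀ x ≠ t, E' b x = E x) ∧ force E = force (E' true) ⊓ force (E' false) := by
  let E' : Bool → X → A → Set X := fun b x c => {z ∈ E x c | x = t ∧ c = a → (z = y ↔ b = true)}
  have hle : ∀ b, E' b ≤ E := fun b x c z hz => hz.1
  have hkeep : ∀ b x c, ¬(x = t ∧ c = a) → E' b x c = E x c := fun b x c h =>
    Set.ext fun z => and_iff_left fun h' => (h h').elim
  have hnonempty : ∀ b x c, (E x c).Nonempty → (E' b x c).Nonempty := fun b x c hc => by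
    by_cases h : x = t ∧ c = a
    · obtain ⟨rfl, rfl⟩ := h
      cases b
      · exact ⟨y', hy', by simp [hne]⟩
      · exact ⟨y, hy, by simp⟩
    · rwa [hkeep b x c h]
  refine ⟨E', fun b => lt_of_le_of_ne (hle b) fun heq => ?_, fun b x => (hE x).imp (hnonempty b x),
    fun b x hx => funext fun c => hkeep b x c (hx ·.1), force_eq_inf hle hnonempty ?_ ?_⟩
  · have heq := congrFun (congrFun heq t) a
    cases b
    · simpa using (heq.ge hy).2 ⟨rfl, rfl⟩
    · simpa [hne] using (heq.ge hy').2 ⟨rfl, rfl⟩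
  · intro x c z hz
    by_cases hzy : z = y
    · exact Or.inl ⟨hz, by simp [hzy]⟩
    · exact Or.inr ⟨hz, by simp [hzy]⟩
  · intro x c c' hcc'
    by_cases h : x = t ∧ c = a
    · exact Or.inr (hkeep _ _ _ fun h' => hcc' (h.2.trans h'.2.symm))
    · exact Or.inl (hkeep _ _ _ h)

/-- `v` is the value of the arena `E`, and both players secure it by positional strategies, which
are taken in the larger graph `E₀`. -/
def IsPositionalValue [LE L] (E₀ : X → X → Prop) (E : X → A → Set X) (val : (ℕ → X) → L)
    (v : X → L) : Prop :=
  SecuresPositionally E₀ (force E) val v ∧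
    SecuresPositionally E₀ (opponent (force E)) (OrderDual.toDual ∘ val) (OrderDual.toDual ∘ v)

section Determinacy

variable {E₀ : X → X → Prop} {E : X → A → Set X} {val : (ℕ → X) → L}

theorem exists_secures_of_ne_actions [LinearOrder L] (hmono : MonotonePayoff E₀ val)
    (hsel : SelectivePayoff E₀ val) (hE : NoDeadEnds E)
    (ih : ∀ E' < E, NoDeadEnds E' → ∃ v, IsPositionalValue E₀ E' val v) {t : X} {a a' : A}
    (ha : (E t a).Nonempty) (ha' : (E t a').Nonempty) (hne : a' ≠ a) :
    ∃ v, SecuresPositionally E₀ (force E) val v ∧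
      Secures (opponent (force E)) (OrderDual.toDual ∘ val) (OrderDual.toDual ∘ v) := by
  obtain ⟨E', hlt, hdead, hoff, heq⟩ := exists_force_eq_sup hE ha ha' hne
  choose v hv using fun b => ih (E' b) (hlt b) (hdead b)
  rw [heq]
  exact exists_secures_sup (f := fun b => force (E' b)) (t := t) hmono hsel
    (fun x hx b b' P => by simp only [mem_force, hoff _ x hx]) (fun b => (hv b).1) fun b => (hv b).2

theorem exists_secures_of_ne_moves [LinearOrder L] (hmono : MonotonePayoff E₀ val)
    (hsel : SelectivePayoff E₀ (OrderDual.toDual ∘ val)) (hE : NoDeadEnds E)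
    (ih : ∀ E' < E, NoDeadEnds E' → ∃ v, IsPositionalValue E₀ E' val v) {t y y' : X} {a : A}
    (hy : y ∈ E t a) (hy' : y' ∈ E t a) (hne : y' ≠ y) :
    ∃ v, Secures (force E) val v ∧ SecuresPositionally E₀ (opponent (force E))
      (OrderDual.toDual ∘ val) (OrderDual.toDual ∘ v) := by
  obtain ⟨E', hlt, hdead, hoff, heq⟩ := exists_force_eq_inf hE hy hy' hne
  choose v hv using fun b => ih (E' b) (hlt b) (hdead b)
  obtain ⟨u, hu, hu'⟩ := exists_secures_sup (f := fun b => opponent (force (E' b)))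
    (v := fun b => OrderDual.toDual ∘ v b) (t := t) hmono.dual hsel
    (fun x hx b b' P => by simp only [mem_opponent_force, hoff _ x hx]) (fun b => (hv b).2)
    fun b => by
      rw [opponent_opponent]
      exact (hv b).1
  rw [← opponent_inf, ← heq] at hu hu'
  rw [opponent_opponent] at hu'
  exact ⟨OrderDual.ofDual ∘ u, hu', hu⟩

theorem Secures.securesPositionally_force [LE L] {v : X → L} (h : Secures (force E) val v)
    (hEE₀ : Move E ≤ E₀) (hE : NoDeadEnds E)
    (hunique : ∀ x a a', (E x a).Nonempty → (E x a').Nonempty → a' = a) :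
    SecuresPositionally E₀ (force E) val v := by
  refine h.securesPositionally hEE₀ hE.mem_force_move ?_
  rintro x P ⟨a, ha, haP⟩ y ⟨a', hy⟩
  obtain rfl := hunique x a a' ha ⟨y, hy⟩
  exact haP hy

theorem Secures.securesPositionally_opponent_force [LE L] {v : X → L}
    (h : Secures (opponent (force E)) val v) (hEE₀ : Move E ≤ E₀)
    (hunique : ∀ x a, (E x a).Subsingleton) :
    SecuresPositionally E₀ (opponent (force E)) val v := by
  refine h.securesPositionally hEE₀ (mem_opponent_force_move E) ?_
  rintro x P hxP y ⟨a, hy⟩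
  obtain ⟨z, hz, hzP⟩ := mem_opponent_force.1 hxP a ⟨y, hy⟩
  rwa [hunique x a hy hz]

theorem exists_isPositionalValue_of_unique_move [Preorder L] (hEE₀ : Move E ≤ E₀)
    (hE : NoDeadEnds E) (hunique : ∀ x y y', Move E x y → Move E x y' → y = y')
    (val : (ℕ → X) → L) : ∃ v, IsPositionalValue E₀ E val v := by
  choose play hplay0 hplay using exists_isPlay hE.exists_move
  have hval : ∀ w, IsPlay (Move E) w → val w = val (play (w 0)) := fun w hw => by
    congr 1
    funext i
    induction i with
    | zero => exact (hplay0 _).symm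
    | succ i ih => exact hunique _ _ _ (hw i) (ih ▸ hplay _ i)
  exact ⟨fun x => val (play x),
    ⟨Move E, hEE₀, fun x => by simpa using hE.mem_force_move x, fun w hw => (hval w hw).ge⟩,
    ⟨Move E, hEE₀, fun x => by simpa using mem_opponent_force_move E x,
      fun w hw => (hval w hw).le⟩⟩

/-- Induction on the arena: an arena in which a player has a choice is split into two smaller
ones. If both players have choices, the values obtained from the two splittings agree. -/
theorem exists_isPositionalValue [LinearOrder L] [Finite X] [Finite A]
    (hmono : MonotonePayoff E₀ val) (hsel : SelectivePayoff E₀ val)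
    (hsel' : SelectivePayoff E₀ (OrderDual.toDual ∘ val))
    (hEE₀ : Move E ≤ E₀) (hE : NoDeadEnds E) : ∃ v, IsPositionalValue E₀ E val v := by
  induction E using WellFoundedLT.induction with
  | ind E ih =>
  have ih : ∀ E' < E, NoDeadEnds E' → ∃ v, IsPositionalValue E₀ E' val v := fun E' hlt hE' =>
    ih E' hlt ((Move.mono hlt.le).trans hEE₀) hE'
  by_cases hactions : ∀ x a a', (E x a).Nonempty → (E x a').Nonempty → a' = a <;>
    by_cases hmoves : ∀ x a, (E x a).Subsingleton
  · refine exists_isPositionalValue_of_unique_move hEE₀ hE ?_ val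
    rintro x y y' ⟨a, hy⟩ ⟨a', hy'⟩
    obtain rfl := hactions x a a' ⟨y, hy⟩ ⟨y', hy'⟩
    exact hmoves x a' hy hy'
  · simp only [Set.Subsingleton] at hmoves
    push Not at hmoves
    obtain ⟨t, a, y, hy, y', hy', hne⟩ := hmoves
    obtain ⟨v, hv, hv'⟩ := exists_secures_of_ne_moves hmono hsel' hE ih hy hy' hne.symm
    exact ⟨v, hv.securesPositionally_force hEE₀ hE hactions, hv'⟩
  · push Not at hactions
    obtain ⟨t, a, a', ha, ha', hne⟩ := hactions
    obtain ⟨v, hv, hv'⟩ := exists_secures_of_ne_actions hmono hsel hE ih ha ha' hne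
    exact ⟨v, hv, hv'.securesPositionally_opponent_force hEE₀ hmoves⟩
  · simp only [Set.Subsingleton] at hmoves
    push Not at hmoves hactions
    obtain ⟨t, a, a', ha, ha', hne⟩ := hactions
    obtain ⟨t', b, y, hy, y', hy', hne'⟩ := hmoves
    obtain ⟨v, hv, hv'⟩ := exists_secures_of_ne_actions hmono hsel hE ih ha ha' hne
    obtain ⟨u, hu, hu'⟩ := exists_secures_of_ne_moves hmono hsel' hE ih hy hy' hne'.symm
    obtain rfl : v = u := le_antisymm (hv.secures.le_of_opponent hu'.secures)
      (hu.le_of_opponent hv')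
    exact ⟨v, hv, hu'⟩

end Determinacy

end PositionalGame

namespace JustificationFrame

open PositionalGame

variable {F : Type u} [FactSpace F] {JF : JustificationFrame F}

/-! ### Branches as plays -/

namespace Branch

/-- A branch as an infinite sequence of facts; the open fact at the end of a finite branch is
repeated forever. -/
def toSeq : JF.Branch → ℕ → F
  | finite l _ o => fun i => (l.map Subtype.val).getD i o.1
  | infinite s => fun i => (s i).1

theorem toSeq_zero (b : JF.Branch) : b.toSeq 0 = b.start := by
  match b with
  | finite (y :: l) _ o => rfl
  | infinite s => rfl

theorem toSeq_finite_of_lt {l : List JF.Defined} (hl : l ≠ []) (o : JF.Open) {i : ℕ}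
    (hi : i < l.length) : (finite l hl o).toSeq i = l[i] := by
  simp [toSeq, hi]

theorem toSeq_finite_of_le {l : List JF.Defined} (hl : l ≠ []) (o : JF.Open) {i : ℕ}
    (hi : l.length ≤ i) : (finite l hl o).toSeq i = o := by
  simp [toSeq, hi]

theorem toSeq_finite_mem_defined_iff {l : List JF.Defined} {hl : l ≠ []} {o : JF.Open} {i : ℕ} :
    (finite l hl o).toSeq i ∈ JF.defined ↔ i < l.length := by
  rcases lt_or_ge i l.length with hi | hi
  · simp [toSeq_finite_of_lt hl o hi, hi]
  · simp [toSeq_finite_of_le hl o hi, hi.not_gt, o.2]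

theorem toSeq_injective : Function.Injective (toSeq : JF.Branch → ℕ → F) := by
  rintro (⟨l, hl, o⟩ | s) (⟨l', hl', o'⟩ | s') h
  · have hlt : ∀ i, i < l.length ↔ i < l'.length := fun i => by
      rw [← toSeq_finite_mem_defined_iff (hl := hl) (o := o), h, toSeq_finite_mem_defined_iff]
    have hlen : l.length = l'.length :=
      le_antisymm (not_lt.1 fun hi => lt_irrefl _ ((hlt _).1 hi))
        (not_lt.1 fun hi => lt_irrefl _ ((hlt _).2 hi))
    obtain rfl : l = l' := List.ext_getElem hlen fun i hi hi' => Subtype.ext <| by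
      rw [← toSeq_finite_of_lt hl o hi, h, toSeq_finite_of_lt hl' o' hi']
    obtain rfl : o = o' := Subtype.ext <| by
      rw [← toSeq_finite_of_le hl o le_rfl, h, toSeq_finite_of_le hl' o' le_rfl]
    rfl
  · have hmem : (finite l hl o).toSeq l.length ∈ JF.defined := h ▸ (s' l.length).2
    exact absurd (toSeq_finite_mem_defined_iff.1 hmem) (lt_irrefl _)
  · have hmem : (finite l' hl' o').toSeq l'.length ∈ JF.defined := h ▸ (s l'.length).2
    exact absurd (toSeq_finite_mem_defined_iff.1 hmem) (lt_irrefl _)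
  · exact congrArg infinite (funext fun i => Subtype.ext (congrFun h i))

theorem toSeq_compl (b : JF.Branch) (i : ℕ) : b.compl.toSeq i = FactSpace.compl (b.toSeq i) := by
  match b with
  | finite l hl o =>
    rcases lt_or_ge i l.length with hi | hi
    · rw [toSeq_finite_of_lt hl o hi, compl, toSeq_finite_of_lt _ _ (by simpa using hi)]
      simp [Defined.compl]
    · rw [toSeq_finite_of_le hl o hi, compl, toSeq_finite_of_le _ _ (by simpa using hi)]
      rfl
  | infinite s => rfl

theorem toSeq_prepend (p : List JF.Defined) (b : JF.Branch) (i : ℕ) :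
    (b.prepend p).toSeq i =
      if h : i < p.length then (p[i] : F) else b.toSeq (i - p.length) := by
  match b with
  | finite l hl o =>
    simp only [prepend, toSeq, List.map_append]
    split_ifs with h
    · rw [List.getD_append _ _ _ _ (by simpa using h)]
      simp [h]
    · rw [List.getD_append_right _ _ _ _ (by simpa using h), List.length_map]
  | infinite s =>
    simp only [prepend, toSeq]
    split_ifs <;> rfl

theorem prepend_nil (b : JF.Branch) : b.prepend [] = b :=
  toSeq_injective (funext fun i => by simp [toSeq_prepend])

theorem exists_toSeq_eq {w : ℕ → F} (hw0 : w 0 ∈ JF.defined)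
    (hw : ∀ i, w i ∉ JF.defined → w (i + 1) = w i) : ∃ b : JF.Branch, b.toSeq = w := by
  classical
  by_cases hopen : ∃ n, w n ∉ JF.defined
  · obtain ⟨n, hn, hmin⟩ : ∃ n, w n ∉ JF.defined ∧ ∀ i < n, w i ∈ JF.defined :=
      ⟨Nat.find hopen, Nat.find_spec hopen, fun i hi => not_not.1 (Nat.find_min hopen hi)⟩
    have hconst : ∀ i ≥ n, w i = w n := fun i hi => by
      induction i, hi using Nat.le_induction with
      | base => rfl
      | succ i _ ih => rw [hw i (ih ▸ hn), ih]
    have hpos : n ≠ 0 := fun h => hn (h ▸ hw0)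
    refine ⟨finite (List.ofFn fun i : Fin n => ⟨w i, hmin i i.2⟩) (by simpa using hpos) ⟨w n, hn⟩,
      funext fun i => ?_⟩
    rcases lt_or_ge i n with hi | hi
    · simp [toSeq_finite_of_lt, hi]
    · simp [toSeq_finite_of_le, hi, hconst i hi]
  · push Not at hopen
    exact ⟨infinite fun i => ⟨w i, hopen i⟩, rfl⟩

end Branch

/-- The arena in which one player chooses a rule for the current fact and the other player chooses
the next fact in its body. At an open fact every action leads back to that fact. -/
def arena (JF : JustificationFrame F) (x : F) (A : Set F) : Set F :=
  {y | (x, A) ∈ JF.rules ∧ y ∈ A ∨ x ∉ JF.defined ∧ y = x}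

theorem move_arena {x y : F} : Move JF.arena x y ↔
    (∃ A, (x, A) ∈ JF.rules ∧ y ∈ A) ∨ x ∉ JF.defined ∧ y = x :=
  exists_or.trans (or_congr_right (exists_const _))

theorem noDeadEnds_arena (JF : JustificationFrame F) : NoDeadEnds JF.arena := fun x => by
  by_cases hx : x ∈ JF.defined
  · obtain ⟨A, hA⟩ := JF.exists_rule x hx
    exact ⟨A, (JF.body_nonempty x A hA).imp fun y hy => Or.inl ⟨hA, hy⟩⟩
  · exact ⟨∅, x, Or.inr ⟨hx, rfl⟩⟩

theorem step_of_move {x y : JF.Defined} (h : Move JF.arena x y) : JF.Step x y :=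
  (move_arena.1 h).resolve_right fun h => h.1 x.2

theorem eq_of_move_of_notMem {x y : F} (h : Move JF.arena x y) (hx : x ∉ JF.defined) : y = x :=
  (move_arena.1 h).elim (fun ⟨A, hA, _⟩ => (hx (JF.head_mem x A hA)).elim) And.right

theorem eq_zero_of_isPlay {w : ℕ → F} (hw : IsPlay (Move JF.arena) w) (hw0 : w 0 ∉ JF.defined)
    (i : ℕ) : w i = w 0 := by
  induction i with
  | zero => rfl
  | succ i ih => rw [eq_of_move_of_notMem (hw i) (ih ▸ hw0), ih]

theorem exists_toSeq_eq_of_isPlay {w : ℕ → F} (hw : IsPlay (Move JF.arena) w)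
    (hw0 : w 0 ∈ JF.defined) : ∃ b : JF.Branch, b.toSeq = w :=
  Branch.exists_toSeq_eq hw0 fun i => eq_of_move_of_notMem (hw i)

open Classical in
/-- The value of a sequence of facts. The sequences that do not come from a branch
are valued by their first fact; among the plays these are the constant plays at open facts. -/
noncomputable def payoff (B : JF.BranchEvaluation) (I : Interpretation F) (w : ℕ → F) : Truth :=
  if h : ∃ b : JF.Branch, b.toSeq = w then I.val (B h.choose) else I.val (w 0)

theorem payoff_toSeq (B : JF.BranchEvaluation) (I : Interpretation F) (b : JF.Branch) :
    payoff B I b.toSeq = I.val (B b) := by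
  have h : ∃ b' : JF.Branch, b'.toSeq = b.toSeq := ⟨b, rfl⟩
  rw [payoff, dif_pos h, Branch.toSeq_injective h.choose_spec]

theorem BranchEvaluation.IsMonotone.monotonePayoff {B : JF.BranchEvaluation} {I : Interpretation F}
    (hB : B.IsMonotone I) : MonotonePayoff (Move JF.arena) (payoff B I) := by
  intro w₁ w₂ h₁ h₂ h0 h1 hle
  by_cases hdef : w₁ 1 ∈ JF.defined
  · have hdef0 : w₁ 0 ∈ JF.defined := by
      by_contra hopen
      exact hopen (eq_of_move_of_notMem (h₁ 0) hopen ▸ hdef)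
    obtain ⟨b₁, hb₁⟩ := exists_toSeq_eq_of_isPlay (h₁.shift 1) hdef
    obtain ⟨b₂, hb₂⟩ := exists_toSeq_eq_of_isPlay (h₂.shift 1) (h1 ▸ hdef)
    have hprepend : ∀ (b : JF.Branch) (w : ℕ → F), b.toSeq = (fun i => w (i + 1)) → w₁ 0 = w 0 →
        (b.prepend [⟨w₁ 0, hdef0⟩]).toSeq = w := fun b w hb hw => funext fun i => by
      cases i <;> simp [Branch.toSeq_prepend, hb, hw]
    rw [← hb₁, ← hb₂, payoff_toSeq, payoff_toSeq] at hle
    rw [← hprepend b₁ w₁ hb₁ rfl, ← hprepend b₂ w₂ hb₂ h0, payoff_toSeq, payoff_toSeq]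
    refine hB b₁ b₂ ⟨w₁ 1, hdef⟩ _ (Subtype.ext ?_) (Subtype.ext ?_) ?_ hle
    · exact (Branch.toSeq_zero b₁).symm.trans (congrFun hb₁ 0)
    · exact (Branch.toSeq_zero b₂).symm.trans ((congrFun hb₂ 0).trans h1.symm)
    · simpa [IsPathTo] using step_of_move (x := ⟨w₁ 0, hdef0⟩) (y := ⟨w₁ 1, hdef⟩) (h₁ 0)
  · suffices w₁ = w₂ by rw [this]
    funext i
    cases i with
    | zero => exact h0
    | succ i =>
      calc w₁ (i + 1) = w₁ 1 := eq_zero_of_isPlay (h₁.shift 1) hdef i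
        _ = w₂ 1 := h1
        _ = w₂ (i + 1) := (eq_zero_of_isPlay (h₂.shift 1) (h1 ▸ hdef) i).symm

/-! ### Selectivity -/

/-- The loops at `x` all of whose steps are edges of the graph `E`. -/
def loops (E : F → F → Prop) (x : JF.Defined) : Set (List JF.Defined) :=
  {q | q.head? = some x ∧ List.IsChain (fun y z : JF.Defined => E y z) (q ++ [x])}

theorem isLoop_of_mem_loops {E : F → F → Prop} (hE : E ≤ Move JF.arena) {x : JF.Defined}
    {q : List JF.Defined} (hq : q ∈ loops E x) : JF.IsLoop x q :=
  ⟨hq.1, hq.2.imp fun _ _ h => step_of_move (hE _ _ h)⟩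

theorem map_range'_mem_loops {E : F → F → Prop} {s : ℕ → JF.Defined} {n m : ℕ} (hnm : n < m)
    (hE : ∀ i, n ≤ i → i < m → E (s i) (s (i + 1))) (hs : s m = s n) :
    (List.range' n (m - n)).map s ∈ loops E (s n) := by
  have hconcat : (List.range' n (m - n)).map s ++ [s n] = (List.range' n (m - n + 1)).map s := by
    rw [List.range'_1_concat, List.map_append, Nat.add_sub_cancel' hnm.le, List.map_singleton, hs]
  refine ⟨by simp [List.head?_range', (Nat.sub_pos_of_lt hnm).ne'], ?_⟩
  rw [hconcat, List.isChain_iff_getElem]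
  intro i hi
  simp only [List.length_map, List.length_range'] at hi
  simpa [add_assoc] using hE (n + i) (by omega) (by omega)

theorem isChain_flatMap_of_mem_loops {E : F → F → Prop} {x : JF.Defined} {q : ℕ → List JF.Defined}
    (hq : ∀ n, q n ∈ loops E x) (n : ℕ) :
    List.IsChain (fun y z : JF.Defined => E y z) ((List.range n).flatMap q ++ [x]) := by
  induction n with
  | zero => simp
  | succ n ih =>
    obtain ⟨tl, htl⟩ := List.head?_eq_some_iff.1 (hq n).1
    have hchain := (hq n).2
    rw [htl] at hchain
    simpa [List.range_succ, htl] using ih.append_overlap hchain (List.cons_ne_nil _ _)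

theorem isPlay_toSeq_of_mem_omega {E : F → F → Prop} {x : JF.Defined} {b : JF.Branch}
    (hb : b ∈ omega (loops E x)) : b.toSeq 0 = x ∧ IsPlay E b.toSeq := by
  obtain ⟨q, s, hq, hs, rfl⟩ := hb
  have hlength : ∀ n, n ≤ ((List.range n).flatMap q).length := fun n => by
    induction n with
    | zero => simp
    | succ n ih =>
      have hne : q n ≠ [] := fun h => by simpa [h] using (hq n).1
      simpa [List.range_succ] using add_le_add ih (List.length_pos_of_ne_nil hne)
  refine ⟨?_, fun i => ?_⟩
  · have hhead := congrArg List.head? (hs 1)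
    rw [List.head?_map, List.head?_range, if_neg (Nat.one_le_iff_ne_zero.1 (hlength 1))] at hhead
    exact congrArg Subtype.val (by simpa [(hq 0).1] using hhead)
  · have hchain := (List.isChain_append.1 (isChain_flatMap_of_mem_loops hq (i + 2))).1
    rw [← hs, List.isChain_iff_getElem] at hchain
    simpa [Branch.toSeq] using
      hchain i ((hlength (i + 2)).trans_eq (by rw [List.length_map, List.length_range]))

theorem map_range_eq_flatMap {α : Type*} (s : ℕ → α) {a : ℕ → ℕ} (ha0 : a 0 = 0) {n : ℕ}
    (ha : ∀ k < n, a k ≤ a (k + 1)) : (List.range (a n)).map s =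
      (List.range n).flatMap fun k => (List.range' (a k) (a (k + 1) - a k)).map s := by
  induction n with
  | zero => simp [ha0]
  | succ n ih =>
    have hsplit : List.range (a (n + 1)) =
        List.range (a n) ++ List.range' (a n) (a (n + 1) - a n) := by
      have happend := List.range'_append_1 (s := 0) (m := a n) (n := a (n + 1) - a n)
      rw [Nat.zero_add, Nat.add_sub_cancel' (ha n n.lt_succ_self)] at happend
      simpa only [List.range_eq_range'] using happend.symm
    rw [hsplit, List.map_append, ih fun k hk => ha k (by omega), List.range_succ]
    simp

theorem mem_defined_of_le {w : ℕ → F} (hw : IsPlay (Move JF.arena) w) {i j : ℕ} (hij : i ≤ j)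
    (hj : w j ∈ JF.defined) : w i ∈ JF.defined := by
  by_contra hi
  have hconst := eq_zero_of_isPlay (hw.shift i) (by simpa using hi) (j - i)
  rw [Nat.sub_add_cancel hij, Nat.zero_add] at hconst
  exact hi (hconst ▸ hj)

section Visits

variable {H : Bool → F → F → Prop} {x : JF.Defined} {w : ℕ → F} {c : ℕ → Bool} {s : ℕ → JF.Defined}

theorem segment_mem_loops (halt : Alternates H x w c) {k : ℕ}
    (hk : ∀ hf : {i | w i = x}.Finite, k + 1 < hf.toFinset.card)
    (hs : ∀ i ≤ Nat.nth (w · = x) (k + 1), (s i : F) = w i) :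
    (List.range' (Nat.nth (w · = x) k) (Nat.nth (w · = x) (k + 1) - Nat.nth (w · = x) k)).map s ∈
      loops (H true) x ∪ loops (H false) x := by
  have hlt : Nat.nth (w · = x) k < Nat.nth (w · = x) (k + 1) :=
    Nat.nth_lt_nth' k.lt_succ_self hk
  have hvisit : w (Nat.nth (w · = x) k) = x :=
    Nat.nth_mem (p := (w · = x)) k fun hf => k.lt_succ_self.trans (hk hf)
  have hvisit' : w (Nat.nth (w · = x) (k + 1)) = x := Nat.nth_mem (p := (w · = x)) (k + 1) hk
  have hne : ∀ i, Nat.nth (w · = x) k < i → i < Nat.nth (w · = x) (k + 1) → w i ≠ x :=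
    fun i hi hi' h => hi.not_ge (Nat.le_nth_of_lt_nth_succ hi' h)
  generalize Nat.nth (w · = x) k = n at *
  generalize Nat.nth (w · = x) (k + 1) = m at *
  obtain rfl : s n = x := Subtype.ext ((hs n hlt.le).trans hvisit)
  have hmem : (List.range' n (m - n)).map s ∈ loops (H (c n)) (s n) :=
    map_range'_mem_loops hlt (fun i hni him => by
      rw [hs i him.le, hs (i + 1) him, ← halt.eq_of_forall_ne hne hni him]
      exact (halt i).1) (Subtype.ext ((hs m le_rfl).trans hvisit'))
  cases hc : c n
  · exact Or.inr (hc ▸ hmem)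
  · exact Or.inl (hc ▸ hmem)

theorem map_range_mem_star (halt : Alternates H x w c) (hw0 : w 0 = x) {n : ℕ} (hn : w n = x)
    (hs : ∀ i ≤ n, (s i : F) = w i) :
    (List.range n).map s ∈ star (loops (H true) x ∪ loops (H false) x) := by
  obtain ⟨k, hk, rfl⟩ := Nat.exists_lt_card_nth_eq (p := (w · = x)) hn
  have hlt : ∀ j < k, ∀ hf : {i | w i = x}.Finite, j + 1 < hf.toFinset.card :=
    fun j hj hf => lt_of_le_of_lt hj (hk hf)
  have hmono : ∀ j < k, Nat.nth (w · = x) (j + 1) ≤ Nat.nth (w · = x) k := fun j hj =>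
    (Nat.succ_le_of_lt hj).eq_or_lt.elim (fun h => h ▸ le_rfl) fun h => (Nat.nth_lt_nth' h hk).le
  refine ⟨_, ?_, (map_range_eq_flatMap s (Nat.nth_zero_of_zero hw0) fun j hj =>
    (Nat.nth_lt_nth' j.lt_succ_self (hlt j hj)).le).trans List.flatMap_def⟩
  rintro _ hq
  obtain ⟨j, hj, rfl⟩ := List.mem_map.1 hq
  have hj := List.mem_range.1 hj
  exact segment_mem_loops halt (hlt j hj) fun i hi => hs i (hi.trans (hmono j hj))

theorem infinite_mem_omega (halt : Alternates H x w c) (hw0 : w 0 = x)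
    (hinf : {i | w i = x}.Infinite) (hs : ∀ i, (s i : F) = w i) :
    Branch.infinite s ∈ omega (loops (H true) x ∪ loops (H false) x) := by
  have hlt : ∀ k, ∀ hf : {i | w i = x}.Finite, k + 1 < hf.toFinset.card :=
    fun k hf => (hinf hf).elim
  have hflatMap := fun n => map_range_eq_flatMap s (Nat.nth_zero_of_zero hw0) (n := n)
    fun k _ => (Nat.nth_lt_nth' k.lt_succ_self (hlt k)).le
  refine ⟨_, s, fun k => segment_mem_loops halt (hlt k) fun i _ => hs i, fun n => ?_, rfl⟩
  rw [← hflatMap, List.length_map, List.length_range]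

end Visits

/-- The branch is cut at its visits of its start; after the last one, if any, it stays in one of the
two graphs. -/
theorem mem_image2_star_union_omega {H : Bool → F → F → Prop} (hH : ∀ e, H e ≤ Move JF.arena)
    {b : JF.Branch} {c : ℕ → Bool} (halt : Alternates H b.start b.toSeq c) :
    b ∈ Set.image2 Branch.prepend (star (loops (H true) b.start ∪ loops (H false) b.start))
        {d | d.start = b.start ∧ ∃ e, IsPlay (H e) d.toSeq} ∪
      omega (loops (H true) b.start ∪ loops (H false) b.start) := by
  classical
  have hplay : IsPlay (Move JF.arena) b.toSeq := fun i => hH _ _ _ (halt i).1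
  let s : ℕ → JF.Defined := fun i =>
    if h : b.toSeq i ∈ JF.defined then ⟨b.toSeq i, h⟩ else b.start
  have hs : ∀ {i n}, b.toSeq n = b.start → i ≤ n → (s i : F) = b.toSeq i := fun {i n} hn hi => by
    simp only [s, dif_pos (mem_defined_of_le hplay hi (hn ▸ b.start.2))]
  by_cases hfin : {i | b.toSeq i = b.start}.Finite
  · obtain ⟨n, hn, hmax⟩ := Set.exists_max_image _ id hfin ⟨0, b.toSeq_zero⟩
    have hn : b.toSeq n = b.start := hn
    obtain ⟨d, hd⟩ := exists_toSeq_eq_of_isPlay (hplay.shift n)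
      (by simpa only [Nat.zero_add, hn] using b.start.2)
    refine Or.inl ⟨_, map_range_mem_star halt b.toSeq_zero hn fun i => hs hn, d,
      ⟨Subtype.ext ?_, c n, ?_⟩, Branch.toSeq_injective (funext fun i => ?_)⟩
    · simpa [hd, hn] using d.toSeq_zero.symm
    · rw [hd]
      simpa using (halt.shift n).isPlay fun i h => by simpa using hmax _ h
    · rw [Branch.toSeq_prepend]
      split_ifs with hi
      · simpa using hs hn (by simpa using hi.le)
      · simp only [List.length_map, List.length_range, not_lt] at hi
        simp [hd, hi]
  · have hs' : ∀ i, (s i : F) = b.toSeq i := fun i => by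
      obtain ⟨n, hn, hi⟩ := Set.Infinite.exists_gt hfin i
      exact hs hn hi.le
    have hmem := infinite_mem_omega halt b.toSeq_zero hfin hs'
    rw [show Branch.infinite s = b from Branch.toSeq_injective (funext hs')] at hmem
    exact Or.inr hmem

theorem BranchEvaluation.IsSelective.exists_between {B : JF.BranchEvaluation} {I : Interpretation F}
    (hB : B.IsSelective I) {H : Bool → F → F → Prop} (hH : ∀ e, H e ≤ Move JF.arena) {w : ℕ → F}
    {c : ℕ → Bool} (halt : Alternates H (w 0) w c) :
    (∃ e d, d 0 = w 0 ∧ IsPlay (H e) d ∧ payoff B I d ≤ payoff B I w) ∧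
      ∃ e d, d 0 = w 0 ∧ IsPlay (H e) d ∧ payoff B I w ≤ payoff B I d := by
  have hplay : IsPlay (Move JF.arena) w := fun i => hH _ _ _ (halt i).1
  by_cases hw0 : w 0 ∈ JF.defined
  · obtain ⟨b, rfl⟩ := exists_toSeq_eq_of_isPlay hplay hw0
    rw [b.toSeq_zero] at halt ⊢
    have hends : ∀ d ∈ omega (loops (H true) b.start) ∪ omega (loops (H false) b.start) ∪
        {d | d.start = b.start ∧ ∃ e, IsPlay (H e) d.toSeq},
        ∃ e, d.toSeq 0 = b.start ∧ IsPlay (H e) d.toSeq := by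
      rintro d ((hd | hd) | ⟨hd, e, he⟩)
      · exact ⟨true, isPlay_toSeq_of_mem_omega hd⟩
      · exact ⟨false, isPlay_toSeq_of_mem_omega hd⟩
      · exact ⟨e, by rw [d.toSeq_zero, hd], he⟩
    obtain ⟨d, hd, d', hd', hle, hle'⟩ := hB [] b.start (List.isChain_singleton _) _ _ _
      (fun q => isLoop_of_mem_loops (hH true)) (fun q => isLoop_of_mem_loops (hH false))
      (fun _ => And.left) b (mem_image2_star_union_omega hH halt)
    simp only [Branch.prepend_nil, ← payoff_toSeq] at hle hle'
    obtain ⟨⟨e, hd0, he⟩, e', hd0', he'⟩ := And.intro (hends d hd) (hends d' hd')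
    exact ⟨⟨e, _, hd0, he, hle⟩, e', _, hd0', he', hle'⟩
  · have hconst : IsPlay (H (c 0)) w := fun i => by
      have hmove := (halt 0).1
      rw [eq_zero_of_isPlay hplay hw0 (0 + 1)] at hmove
      rwa [eq_zero_of_isPlay hplay hw0 i, eq_zero_of_isPlay hplay hw0 (i + 1)]
    exact ⟨⟨_, w, rfl, hconst, le_rfl⟩, _, w, rfl, hconst, le_rfl⟩

theorem BranchEvaluation.IsSelective.selectivePayoff {B : JF.BranchEvaluation}
    {I : Interpretation F} (hB : B.IsSelective I) :
    SelectivePayoff (Move JF.arena) (payoff B I) :=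
  fun _ hH _ _ halt => (hB.exists_between hH halt).2

theorem BranchEvaluation.IsSelective.selectivePayoff_dual {B : JF.BranchEvaluation}
    {I : Interpretation F} (hB : B.IsSelective I) :
    SelectivePayoff (Move JF.arena) (OrderDual.toDual ∘ payoff B I) :=
  fun _ hH _ _ halt => (hB.exists_between hH halt).1

/-! ### Justifications as strategies -/

theorem mem_force_arena {P : Set F} {x : F} :
    x ∈ force JF.arena P ↔ (∃ A, (x, A) ∈ JF.rules ∧ A ⊆ P) ∨ x ∉ JF.defined ∧ x ∈ P := by
  constructor
  · rintro ⟨A, ⟨y, ⟨hA, -⟩ | ⟨hx, -⟩⟩, hAP⟩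
    · exact Or.inl ⟨A, hA, fun z hz => hAP (Or.inl ⟨hA, hz⟩)⟩
    · exact Or.inr ⟨hx, hAP (Or.inr ⟨hx, rfl⟩)⟩
  · rintro (⟨A, hA, hAP⟩ | ⟨hx, hxP⟩)
    · refine ⟨A, (JF.body_nonempty x A hA).imp fun y hy => Or.inl ⟨hA, hy⟩, ?_⟩
      rintro y (⟨-, hy⟩ | ⟨hx, -⟩)
      · exact hAP hy
      · exact (hx (JF.head_mem x A hA)).elim
    · refine ⟨∅, ⟨x, Or.inr ⟨hx, rfl⟩⟩, ?_⟩
      rintro y (⟨-, hy⟩ | ⟨-, rfl⟩)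
      · exact hy.elim
      · exact hxP

theorem compl_mem_defined_iff {x : F} : FactSpace.compl x ∈ JF.defined ↔ x ∈ JF.defined :=
  ⟨fun h => FactSpace.compl_compl x ▸ JF.compl_mem _ h, JF.compl_mem x⟩

/-- The answers of the opponent form a selection function. -/
theorem IsComplementary.compl_mem_force (hJF : JF.IsComplementary) {P : Set F} {x : F}
    (hx : x ∈ opponent (force JF.arena) P) :
    FactSpace.compl x ∈ force JF.arena (FactSpace.compl '' P) := by
  rw [mem_opponent, mem_force_arena, not_or] at hx
  rw [mem_force_arena]
  by_cases hdef : x ∈ JF.defined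
  · have hmeet : ∀ A ∈ JF.cases x, ∃ y ∈ A, y ∈ P := fun A hA => by
      by_contra! h
      exact hx.1 ⟨A, hA, h⟩
    have : Nonempty F := ⟨x⟩
    choose! s hs using hmeet
    refine Or.inl ⟨FactSpace.compl '' (s '' JF.cases x), hJF.subset
      (Or.inr ⟨x, hdef, s, fun A hA => (hs A hA).1, rfl⟩), Set.image_mono ?_⟩
    rintro _ ⟨A, hA, rfl⟩
    exact (hs A hA).2
  · refine Or.inr ⟨compl_mem_defined_iff.not.2 hdef, x, ?_, rfl⟩
    by_contra hxP
    exact hx.2 ⟨hdef, hxP⟩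

theorem HasOpposedRules.compl_mem_opponent_force (hJF : JF.HasOpposedRules) {P : Set F} {x : F}
    (hx : x ∈ force JF.arena P) :
    FactSpace.compl x ∈ opponent (force JF.arena) (FactSpace.compl '' P) := by
  rw [mem_opponent, mem_force_arena, not_or]
  rcases mem_force_arena.1 hx with ⟨A, hA, hAP⟩ | ⟨hdef, hxP⟩
  · refine ⟨?_, fun h => h.1 (JF.compl_mem x (JF.head_mem x A hA))⟩
    rintro ⟨B, hB, hBP⟩
    obtain ⟨_, hy, y, hyB, rfl⟩ := hJF x A B hA hB
    exact hBP hyB ⟨_, hAP hy, FactSpace.compl_compl y⟩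
  · refine ⟨?_, fun h => h.2 ⟨x, hxP, rfl⟩⟩
    rintro ⟨B, hB, -⟩
    exact hdef (compl_mem_defined_iff.1 (JF.head_mem _ B hB))

theorem IsComplementary.isStrategy_compl (hJF : JF.IsComplementary) {Q : Type*} {label : Q → F}
    {G : Q → Q → Prop} (hG : IsStrategy (opponent (force JF.arena)) label G) :
    IsStrategy (force JF.arena) (FactSpace.compl ∘ label) G := fun q => by
  rw [Set.image_comp]
  exact hJF.compl_mem_force (hG q)

theorem HasOpposedRules.isStrategy_compl (hJF : JF.HasOpposedRules) {Q : Type*} {label : Q → F}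
    {G : Q → Q → Prop} (hG : IsStrategy (force JF.arena) label G) :
    IsStrategy (opponent (force JF.arena)) (FactSpace.compl ∘ label) G := fun q => by
  rw [Set.image_comp]
  exact hJF.compl_mem_opponent_force (hG q)

end JustificationFrame

namespace LabelledGraph

variable {F : Type u}

/-- The edges of `J`, together with a loop at every leaf, so that all maximal paths become
infinite. -/
def stutter (J : LabelledGraph F) (n m : J.Node) : Prop := J.edge n m ∨ J.IsLeaf n ∧ m = n

/-- The unravelling of `J` into trees: a node of `J` is paired with the list of the nodes passed on
the way to it. -/
def unravel (J : LabelledGraph F) : LabelledGraph F where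
  Node := J.Node × List J.Node
  edge p q := J.edge p.1 q.1 ∧ q.2 = p.1 :: p.2
  label p := J.label p.1

theorem isAcyclic_fromRel {α : Type*} {r : α → α → Prop}
    (hunique : ∀ a b c, r a c → r b c → a = b) (hirrefl : ∀ a, ¬ Relation.TransGen r a a) :
    (SimpleGraph.fromRel r).IsAcyclic := by
  suffices hbridge : ∀ a b, r a b → (SimpleGraph.fromRel r).IsBridge s(a, b) by
    rw [SimpleGraph.isAcyclic_iff_forall_adj_isBridge]
    rintro a b ⟨-, h | h⟩
    · exact hbridge a b h
    · exact Sym2.eq_swap ▸ hbridge b a h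
  intro a b hab
  rw [SimpleGraph.isBridge_iff]
  rintro ⟨p⟩
  have hdesc : ∀ {x y}, ((SimpleGraph.fromRel r).deleteEdges {s(a, b)}).Walk x y →
      Relation.ReflTransGen r b y → Relation.ReflTransGen r b x := fun {x y} p hy => by
    induction p with
    | nil => exact hy
    | @cons x z y h p ih =>
      have hz := ih hy
      simp only [SimpleGraph.deleteEdges_adj, SimpleGraph.fromRel_adj] at h
      obtain ⟨⟨-, hxz | hzx⟩, hne⟩ := h
      · rcases hz.cases_tail with rfl | ⟨c, hbc, hcz⟩
        · exact absurd (hunique _ _ _ hxz hab) (by rintro rfl; simp at hne)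
        · exact hunique _ _ _ hcz hxz ▸ hbc
      · exact hz.tail hzx
  exact hirrefl a (Relation.TransGen.head' hab (hdesc p .refl))

theorem isForest_unravel (J : LabelledGraph F) : J.unravel.IsForest := by
  have hlength : ∀ p q, Relation.TransGen J.unravel.edge p q → p.2.length < q.2.length := by
    intro p q h
    refine Relation.TransGen.trans_induction_on h ?_ fun _ _ => lt_trans
    intro p q h
    simp [h.2]
  refine ⟨isAcyclic_fromRel ?_ fun p h => lt_irrefl _ (hlength p p h), fun p q h h' =>
    lt_irrefl _ (hlength p p (.tail (.single h) h'))⟩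
  rintro ⟨a, l⟩ ⟨b, m⟩ c h h'
  obtain ⟨rfl, rfl⟩ : a = b ∧ l = m := by simpa using h.2.symm.trans h'.2
  rfl

theorem unravel_isLeaf_iff {J : LabelledGraph F} {p : J.unravel.Node} :
    J.unravel.IsLeaf p ↔ J.IsLeaf p.1 :=
  not_congr ⟨fun ⟨q, hq⟩ => ⟨q.1, hq.1⟩, fun ⟨m, hm⟩ => ⟨(m, p.1 :: p.2), hm, rfl⟩⟩

end LabelledGraph

namespace JustificationFrame

variable {F : Type u} [FactSpace F] {JF : JustificationFrame F} {B : JF.BranchEvaluation}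
  {I : Interpretation F} {J : LabelledGraph F}

open PositionalGame

theorem IsJustification.isStrategy_stutter (hJ : JF.IsJustification J)
    (hlc : JF.IsLocallyComplete J) : IsStrategy (force JF.arena) J.label J.stutter := fun n => by
  rw [mem_force_arena]
  by_cases hn : J.IsInternal n
  · refine Or.inl ⟨_, hJ n hn, ?_⟩
    rintro _ ⟨m, hm, rfl⟩
    exact ⟨m, Or.inl hm, rfl⟩
  · exact Or.inr ⟨hlc n hn, n, Or.inr ⟨hn, rfl⟩, rfl⟩

theorem IsJustification.move_of_stutter (hJ : JF.IsJustification J)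
    (hlc : JF.IsLocallyComplete J) {n m : J.Node} (h : J.stutter n m) :
    Move JF.arena (J.label n) (J.label m) := by
  rcases h with h | ⟨hn, rfl⟩
  · exact move_arena.2 (Or.inl ⟨_, hJ n ⟨m, h⟩, m, h, rfl⟩)
  · exact move_arena.2 (Or.inr ⟨hlc m hn, rfl⟩)

theorem IsBranchOf.toSeq_zero {x : F} {b : JF.Branch} (hb : JF.IsBranchOf J x b) :
    b.toSeq 0 = x := by
  rw [b.toSeq_zero]
  cases b <;> exact hb.1

theorem IsBranchOf.exists_isPlay_stutter {x : F} {b : JF.Branch} (hb : JF.IsBranchOf J x b) :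
    ∃ w, IsPlay J.stutter w ∧ J.label ∘ w = b.toSeq := by
  match b, hb with
  | .finite l hl o, ⟨_, ns, m, hchain, hleaf, hlabel, hm⟩ =>
    have hget : ∀ i (hi : i < (ns ++ [m]).length), (ns ++ [m])[i] = ns.getD i m := by grind
    refine ⟨fun i => ns.getD i m, fun i => ?_, funext fun i => ?_⟩
    · rcases lt_or_ge i ns.length with hi | hi
      · have hedge := List.isChain_iff_getElem.1 hchain i (by simpa using hi)
        rw [hget, hget] at hedge
        exact Or.inl hedge
      · exact Or.inr (by simp [hi, hi.trans (Nat.le_succ i), hleaf])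
    · simp [Branch.toSeq, ← hlabel, ← hm]
  | .infinite s, ⟨_, w, hw, hlabel⟩ => exact ⟨w, fun i => Or.inl (hw i), funext hlabel⟩

theorem IsJustification.isBranchOf_of_isPlay_stutter (hJ : JF.IsJustification J)
    (hlc : JF.IsLocallyComplete J) {w : ℕ → J.Node} (hw : IsPlay J.stutter w) {b : JF.Branch}
    (hb : J.label ∘ w = b.toSeq) : JF.IsBranchOf J (J.label (w 0)) b := by
  have hedge : ∀ i, b.toSeq i ∈ JF.defined → J.edge (w i) (w (i + 1)) := fun i hi =>
    (hw i).resolve_right fun h => hlc _ h.1 (by rwa [← hb] at hi)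
  have hstart : b.start.1 = J.label (w 0) := by
    rw [← b.toSeq_zero, ← hb, Function.comp_apply]
  match b with
  | .finite l hl o =>
    have hlast : J.label (w l.length) = o :=
      (congrFun hb _).trans (Branch.toSeq_finite_of_le hl o le_rfl)
    refine ⟨hstart, (List.range l.length).map w, w l.length, ?_, fun h => ?_, ?_, hlast⟩
    · rw [show [w l.length] = [l.length].map w from rfl, ← List.map_append, ← List.range_succ,
        List.isChain_iff_getElem]
      intro i hi
      simpa using hedge i (Branch.toSeq_finite_mem_defined_iff.2 (by simpa using hi))
    · exact o.2 (hlast ▸ JF.head_mem _ _ (hJ _ h))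
    · refine List.ext_getElem (by simp) fun i hi hi' => ?_
      have hi' : i < l.length := by simpa using hi'
      simpa using (congrFun hb i).trans (Branch.toSeq_finite_of_lt hl o hi')
  | .infinite s => exact ⟨hstart, w, fun i => hedge i (s i).2, congrFun hb⟩

theorem IsJustification.justValue_le_payoff (hJ : JF.IsJustification J)
    (hlc : JF.IsLocallyComplete J) {w : ℕ → J.Node} (hw : IsPlay J.stutter w)
    (hdef : J.label (w 0) ∈ JF.defined) :
    JF.justValue B J (J.label (w 0)) I ≤ payoff B I (J.label ∘ w) := by
  obtain ⟨b, hb⟩ := exists_toSeq_eq_of_isPlay (w := J.label ∘ w)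
    (fun i => hJ.move_of_stutter hlc (hw i)) hdef
  rw [← hb, payoff_toSeq]
  exact sInf_le ⟨b, hJ.isBranchOf_of_isPlay_stutter hlc hw hb.symm, rfl⟩

theorem exists_isJustification_of_isStrategy {Q : Type u} {label : Q → F}
    (hlabel : Function.Injective label) {G : Q → Q → Prop}
    (hG : IsStrategy (force JF.arena) label G) :
    ∃ E : Q → Q → Prop, JF.IsJustification ⟨Q, E, label⟩ ∧ JF.IsLocallyComplete ⟨Q, E, label⟩ ∧
      LabelledGraph.stutter ⟨Q, E, label⟩ ≤ G := by
  have hrule : ∀ q, label q ∈ JF.defined →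
      ∃ A, (label q, A) ∈ JF.rules ∧ A ⊆ label '' {q' | G q q'} := fun q hq =>
    (mem_force_arena.1 (hG q)).resolve_right fun h => h.1 hq
  choose! body hbody hsub using hrule
  let E : Q → Q → Prop := fun q q' => label q ∈ JF.defined ∧ label q' ∈ body q ∧ G q q'
  have hlc : JF.IsLocallyComplete ⟨Q, E, label⟩ := fun q hleaf hq => by
    obtain ⟨y, hy⟩ := JF.body_nonempty _ _ (hbody q hq)
    obtain ⟨q', hq', rfl⟩ := hsub q hq hy
    exact hleaf ⟨q', hq, hy, hq'⟩
  refine ⟨E, ?_, hlc, ?_⟩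
  · rintro q ⟨-, hq, -⟩
    have hchildren : {y | ∃ q', E q q' ∧ y = label q'} = body q := by
      refine Set.Subset.antisymm ?_ fun y hy => ?_
      · rintro _ ⟨q', h, rfl⟩
        exact h.2.1
      · obtain ⟨q', hq', rfl⟩ := hsub q hq hy
        exact ⟨q', ⟨hq, hy, hq'⟩, rfl⟩
    exact hchildren ▸ hbody q hq
  · rintro q q' (h | ⟨hleaf, rfl⟩)
    · exact h.2.2
    · obtain ⟨q, hq, heq⟩ := ((mem_force_arena.1 (hG q')).resolve_left
        fun ⟨A, hA, _⟩ => hlc q' hleaf (JF.head_mem _ _ hA)).2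
      exact hlabel heq ▸ hq

theorem le_graphSupportedValue_of_isStrategy {Q : Type u} {label : Q → F}
    (hlabel : Function.Injective label) {G : Q → Q → Prop}
    (hG : IsStrategy (force JF.arena) label G) {q : Q} (hq : label q ∈ JF.defined) {v : Truth}
    (hv : ∀ w, IsPlay G w → w 0 = q → v ≤ payoff B I (label ∘ w)) :
    v ≤ JF.graphSupportedValue B (label q) I := by
  obtain ⟨E, hJ, hlc, hE⟩ := exists_isJustification_of_isStrategy hlabel hG
  rw [graphSupportedValue, if_pos hq]
  refine le_sSup_of_le ⟨⟨Q, E, label⟩, ⟨hJ, hlabel⟩, hlc, ⟨q, rfl⟩, rfl⟩ (le_sInf ?_)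
  rintro _ ⟨b, hb, rfl⟩
  obtain ⟨w, hw, hwb⟩ := hb.exists_isPlay_stutter
  have hw0 : w 0 = q := hlabel ((congrFun hwb 0).trans hb.toSeq_zero)
  rw [← payoff_toSeq, ← hwb]
  exact hv w (hw.mono hE) hw0

theorem graphSupportedValue_le_of_securesPositionally {v : F → Truth}
    (hv : SecuresPositionally (Move JF.arena) (force JF.arena) (payoff B I) v) {x : F}
    (hx : x ∈ JF.defined) : v x ≤ JF.graphSupportedValue B x I := by
  obtain ⟨G, -, hG, hval⟩ := hv
  exact le_graphSupportedValue_of_isStrategy Function.injective_id hG hx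
    fun w hw hw0 => hw0 ▸ hval w hw

/-! ### Complementation -/

theorem payoff_compl (hB : B.IsConsistent) (w : ℕ → F) :
    payoff B I (FactSpace.compl ∘ w) = (payoff B I w).neg := by
  have hcompl : ∀ b : JF.Branch, FactSpace.compl ∘ b.toSeq = b.compl.toSeq := fun b =>
    funext fun i => (b.toSeq_compl i).symm
  by_cases h : ∃ b : JF.Branch, b.toSeq = w
  · obtain ⟨b, rfl⟩ := h
    rw [hcompl, payoff_toSeq, payoff_toSeq, hB, I.val_compl]
  · have h' : ¬∃ b : JF.Branch, b.toSeq = FactSpace.compl ∘ w := by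
      rintro ⟨b, hb⟩
      refine h ⟨b.compl, ?_⟩
      rw [← hcompl, hb]
      exact funext fun i => FactSpace.compl_compl (w i)
    rw [payoff, payoff, dif_neg h, dif_neg h']
    exact I.val_compl (w 0)

theorem compl_injective : Function.Injective (FactSpace.compl : F → F) :=
  Function.LeftInverse.injective FactSpace.compl_compl

theorem IsComplementary.neg_le_graphSupportedValue_compl (hJF : JF.IsComplementary)
    (hB : B.IsConsistent) {v : F → Truth}
    (hv : SecuresPositionally (Move JF.arena) (opponent (force JF.arena))
      (OrderDual.toDual ∘ payoff B I) (OrderDual.toDual ∘ v)) {x : F} (hx : x ∈ JF.defined) :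
    (v x).neg ≤ JF.graphSupportedValue B (FactSpace.compl x) I := by
  obtain ⟨G, -, hG, hval⟩ := hv
  refine le_graphSupportedValue_of_isStrategy compl_injective (hJF.isStrategy_compl hG)
    (JF.compl_mem x hx) fun w hw hw0 => ?_
  rw [payoff_compl hB]
  exact Truth.neg_le_neg_iff.2 (hw0 ▸ hval w hw)

theorem HasOpposedRules.justValue_le_neg_justValue_compl (hJF : JF.HasOpposedRules)
    (hB : B.IsConsistent) {J' : LabelledGraph F} (hJ : JF.IsJustification J)
    (hlc : JF.IsLocallyComplete J) (hJ' : JF.IsJustification J') (hlc' : JF.IsLocallyComplete J')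
    {n : J.Node} {n' : J'.Node} (hn : J.label n ∈ JF.defined)
    (hnn' : J'.label n' = FactSpace.compl (J.label n)) :
    JF.justValue B J (J.label n) I ≤ (JF.justValue B J' (J'.label n') I).neg := by
  have hstart : J.label n = FactSpace.compl (J'.label n') := by rw [hnn', FactSpace.compl_compl]
  have hn' : J'.label n' ∈ JF.defined := hnn' ▸ JF.compl_mem _ hn
  obtain ⟨w, w', hw, hw', rfl, rfl, heq⟩ := (hJ.isStrategy_stutter hlc).exists_common_play
    (hJF.isStrategy_compl (hJ'.isStrategy_stutter hlc')) hstart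
  calc JF.justValue B J (J.label (w 0)) I ≤ payoff B I (J.label ∘ w) :=
        hJ.justValue_le_payoff hlc hw hn
    _ = (payoff B I (J'.label ∘ w')).neg := by rw [heq, Function.comp_assoc, payoff_compl hB]
    _ ≤ (JF.justValue B J' (J'.label (w' 0)) I).neg :=
        Truth.neg_le_neg_iff.2 (hJ'.justValue_le_payoff hlc' hw' hn')

theorem HasOpposedRules.treeSupportedValue_le_neg (hJF : JF.HasOpposedRules)
    (hB : B.IsConsistent) {x : F} (hx : x ∈ JF.defined) :
    JF.treeSupportedValue B x I ≤ (JF.treeSupportedValue B (FactSpace.compl x) I).neg := by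
  rw [treeSupportedValue, treeSupportedValue, if_pos hx, if_pos (JF.compl_mem x hx)]
  refine sSup_le ?_
  rintro _ ⟨J, hJ, hlc, ⟨n, rfl⟩, rfl⟩
  rw [Truth.le_neg_comm]
  refine sSup_le ?_
  rintro _ ⟨J', hJ', hlc', ⟨n', hlabel⟩, rfl⟩
  rw [Truth.le_neg_comm, ← hlabel]
  exact hJF.justValue_le_neg_justValue_compl hB hJ.1 hlc hJ'.1 hlc' hx hlabel

/-! ### Unravelling -/

theorem IsJustification.unravel (hJ : JF.IsJustification J) : JF.IsJustification J.unravel := by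
  rintro p ⟨q, hq⟩
  have hchildren : {y | ∃ q, J.unravel.edge p q ∧ y = J.unravel.label q} =
      {y | ∃ m, J.edge p.1 m ∧ y = J.label m} := Set.ext fun y =>
    ⟨fun ⟨q, hq, hy⟩ => ⟨q.1, hq.1, hy⟩, fun ⟨m, hm, hy⟩ => ⟨(m, p.1 :: p.2), ⟨hm, rfl⟩, hy⟩⟩
  rw [hchildren]
  exact hJ p.1 ⟨q.1, hq.1⟩

theorem IsLocallyComplete.unravel (hlc : JF.IsLocallyComplete J) :
    JF.IsLocallyComplete J.unravel := fun p hp => hlc p.1 (LabelledGraph.unravel_isLeaf_iff.1 hp)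

theorem IsJustification.isBranchOf_of_unravel (hJ : JF.IsJustification J)
    (hlc : JF.IsLocallyComplete J) {x : F} {b : JF.Branch} (hb : JF.IsBranchOf J.unravel x b) :
    JF.IsBranchOf J x b := by
  obtain ⟨w, hw, hwb⟩ := hb.exists_isPlay_stutter
  have hplay : IsPlay J.stutter fun i => (w i).1 := fun i => (hw i).imp And.left fun h =>
    ⟨LabelledGraph.unravel_isLeaf_iff.1 h.1, congrArg Prod.fst h.2⟩
  have hx : J.label (w 0).1 = x := (congrFun hwb 0).trans hb.toSeq_zero
  exact hx ▸ hJ.isBranchOf_of_isPlay_stutter hlc hplay hwb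

theorem graphSupportedValue_le_treeSupportedValue (x : F) :
    JF.graphSupportedValue B x I ≤ JF.treeSupportedValue B x I := by
  rw [graphSupportedValue, treeSupportedValue]
  split_ifs
  · refine sSup_le ?_
    rintro _ ⟨J, hJ, hlc, ⟨n, hn⟩, rfl⟩
    refine le_sSup_of_le ⟨J.unravel, ⟨hJ.1.unravel, J.isForest_unravel⟩, hlc.unravel,
      ⟨(n, []), hn⟩, rfl⟩ (sInf_le_sInf ?_)
    rintro _ ⟨b, hb, rfl⟩
    exact ⟨b, hJ.1.isBranchOf_of_unravel hlc hb, rfl⟩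
  · exact le_rfl

/-- All inequalities in
`v x ≤ SV_g x ≤ SV_t x ≤ ∼SV_t (∼x) ≤ ∼SV_g (∼x) ≤ ∼∼v x` are equalities. -/
theorem supportedValues_eq_of_isPositionalValue (hcompl : JF.IsComplementary)
    (hopp : JF.HasOpposedRules) (hB : B.IsConsistent) {v : F → Truth}
    (hv : IsPositionalValue (Move JF.arena) JF.arena (payoff B I) v) {x : F} (hx : x ∈ JF.defined) :
    JF.graphSupportedValue B x I = v x ∧ JF.treeSupportedValue B x I = v x ∧
      JF.graphSupportedValue B (FactSpace.compl x) I = (v x).neg := by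
  have hgraph : v x ≤ JF.graphSupportedValue B x I :=
    graphSupportedValue_le_of_securesPositionally hv.1 hx
  have htree : JF.graphSupportedValue B x I ≤ JF.treeSupportedValue B x I :=
    graphSupportedValue_le_treeSupportedValue x
  have hneg : JF.graphSupportedValue B (FactSpace.compl x) I ≤
      (JF.treeSupportedValue B x I).neg :=
    (graphSupportedValue_le_treeSupportedValue _).trans
      (Truth.le_neg_comm.1 (hopp.treeSupportedValue_le_neg hB hx))
  have hdual : (v x).neg ≤ JF.graphSupportedValue B (FactSpace.compl x) I :=
    hcompl.neg_le_graphSupportedValue_compl hB hv.2 hx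
  have htree' : JF.treeSupportedValue B x I ≤ v x := Truth.neg_le_neg_iff.1 (hdual.trans hneg)
  exact ⟨(htree.trans htree').antisymm hgraph, htree'.antisymm (hgraph.trans htree),
    (hneg.trans (Truth.neg_le_neg_iff.2 (hgraph.trans htree))).antisymm hdual⟩

end JustificationFrame

theorem mainTheorem2 {F : Type u} [FactSpace F] [Finite F] (JF : JustificationFrame F)
    (hcompl : JF.IsComplementary) (hopp : JF.HasOpposedRules)
    (B : JF.BranchEvaluation) (hcons : B.IsConsistent)
    (I : Interpretation F) (hmono : B.IsMonotone I) (hsel : B.IsSelective I) :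
    (∀ x ∈ JF.defined, JF.graphSupportedValue B (FactSpace.compl x) I =
      (JF.graphSupportedValue B x I).neg) ∧
    (∀ x, JF.graphSupportedValue B x I = JF.treeSupportedValue B x I) := by
  obtain ⟨v, hv⟩ := PositionalGame.exists_isPositionalValue hmono.monotonePayoff
    hsel.selectivePayoff hsel.selectivePayoff_dual le_rfl JF.noDeadEnds_arena
  have hdef : ∀ x ∈ JF.defined, JF.graphSupportedValue B x I = v x ∧
      JF.treeSupportedValue B x I = v x ∧
      JF.graphSupportedValue B (FactSpace.compl x) I = (v x).neg :=
    fun x hx => JustificationFrame.supportedValues_eq_of_isPositionalValue hcompl hopp hcons hv hx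
  refine ⟨fun x hx => ?_, fun x => ?_⟩
  · obtain ⟨hgraph, -, hneg⟩ := hdef x hx
    rw [hneg, hgraph]
  · by_cases hx : x ∈ JF.defined
    · obtain ⟨hgraph, htree, -⟩ := hdef x hx
      rw [hgraph, htree]
    · rw [JustificationFrame.graphSupportedValue, JustificationFrame.treeSupportedValue, if_neg hx,
        if_neg hx]
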